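/- Let $b>w$ be positive integers and let $\lambda,\mu_d,t>0$. Let $(N_s)_{s\ge 0}$ and $(M^d_s)_{s\ge 0}$ be independent homogeneous Poisson processes with intensities $\lambda$ and $\mu_d$, started at $0$. Here $N_s$ counts the blocks found by a mining pool and $M^d_s$ counts the submitted shares that are not blocks, so that $M_s=N_s+M^d_s$ counts all shares. Let $T$ be exponentially distributed with mean $t$ and independent of $(N,M^d)$. The pool manager with initial surplus $u$ pays $w$ for every share and receives $b$ for every block, so the surplus is $$R_s=u-wM_s+bN_s=u-w\,M^d_s+(b-w)\,N_s,\qquad s\ge 0.$$ Let $\tau=\inf\{s\ge 0: R_s<0\}$ (with $\inf\emptyset=\infty$) and $\widehat V(u,t)=\mathbb E\big(R_T\,\mathbb 1_{\{\tau>T\}}\big)$. Then the equation $$\lambda x^{b}-\Big(\lambda+\mu_d+\frac1t\Big)x^{w}+\mu_d=0$$ has exactly $w$ complex roots $x_1,\dots,x_w$ in the open unit disk, counted with multiplicity, and these are pairwise distinct. The linear system $$\sum_{i=1}^{w}\Big(\lambda x_i^{\,b-w+j-1}-\Big(\lambda+\mu_d+\frac1t\Big)x_i^{\,j-1}\Big)c_i=A_j,\qquad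 j=1,\dots,w,$$ with $$A_j=(j-1)\mu_d+\mu_d t\big(\lambda b-(\lambda+\mu_d)w\big)-\mu_d w,$$ has a unique solution $(c_1,\dots,c_w)\in\mathbb C^w$. For every integer $u\ge 0$, the random variable $R_T\,\mathbb 1_{\{\tau>T\}}$ is integrable and $$\widehat V(u,t)=\sum_{i=1}^{w}c_i x_i^{u}+u+\lambda b t-(\lambda+\mu_d)wt .$$ -/

import Mathlib

open MeasureTheory ProbabilityTheory
open scoped NNReal ENNReal Polynomial

noncomputable section

/-- `N` is a homogeneous Poisson process of intensity `r` under `P`: a counting process started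
at `0`, with nondecreasing right-continuous `ℕ`-valued paths and independent increments, the
increment over `[s, t]` being Poisson distributed with mean `r * (t - s)`. (The truncated
subtraction on `ℕ` is harmless, since the paths are nondecreasing.) -/
structure IsPoissonProcess {Ω : Type*} [MeasurableSpace Ω] (N : ℝ≥0 → Ω → ℕ) (r : ℝ)
    (P : Measure Ω) : Prop where
  measurable : ∀ s, Measurable (N s)
  zero : ∀ ω, N 0 ω = 0
  mono : ∀ ω, Monotone fun s => N s ω
  rightCont : ∀ ω s, ContinuousWithinAt (fun s' => N s' ω) (Set.Ici s) s
  indep : HasIndepIncrements N P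
  law : ∀ s t : ℝ≥0, s ≤ t →
    HasLaw (fun ω => N t ω - N s ω) (poissonMeasure (Real.toNNReal (r * ((t : ℝ) - s)))) P

/-- All shares submitted to the pool: `N` counts those that are also full solutions (blocks),
`Md` counts those that are not. -/
def shareProcess {Ω : Type*} (N Md : ℝ≥0 → Ω → ℕ) : ℝ≥0 → Ω → ℕ :=
  fun s ω => N s ω + Md s ω

/-- The surplus of a pay-per-share pool manager with initial surplus `u`, who pays `w` for each
share (counted by `M`) and receives `b` for each block (counted by `N`). -/
def poolSurplus {Ω : Type*} (u b w : ℝ) (N M : ℝ≥0 → Ω → ℕ) : ℝ≥0 → Ω → ℝ :=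
  fun s ω => u - M s ω * w + N s ω * b

/-- The ruin time `inf {s ≥ 0 : R s < 0}`, equal to `∞` if there is no such `s`. -/
def ruinTime {Ω : Type*} (R : ℝ≥0 → Ω → ℝ) : Ω → WithTop ℝ≥0 :=
  hittingAfter R (Set.Iio 0) 0

/-- The random variable `R_T * 1_{τ > T}`, where `τ` is the ruin time of `R`. -/
def survivingSurplus {Ω : Type*} (R : ℝ≥0 → Ω → ℝ) (T : Ω → ℝ≥0) : Ω → ℝ :=
  Set.indicator {ω | (T ω : WithTop ℝ≥0) < ruinTime R ω} fun ω => R (T ω) ω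

/-- The polynomial `lam * x ^ b - (lam + mud + 1 / t) * x ^ w + mud`. -/
def poolPoly (lam mud t : ℝ) (b w : ℕ) : ℂ[X] :=
  Polynomial.C (lam : ℂ) * Polynomial.X ^ b
    - Polynomial.C ((lam + mud + 1 / t : ℝ) : ℂ) * Polynomial.X ^ w
    + Polynomial.C (mud : ℂ)

/-- The roots of `poolPoly` in the open unit disk, listed with multiplicity. -/
def diskRoots (lam mud t : ℝ) (b w : ℕ) : Multiset ℂ :=
  (poolPoly lam mud t b w).roots.filter fun z => ‖z‖ < 1

/-- The matrix of the linear system; rows are indexed by `j = 0, …, w - 1`. -/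
def poolMatrix (lam mud t : ℝ) (b w : ℕ) (x : Fin w → ℂ) : Matrix (Fin w) (Fin w) ℂ :=
  Matrix.of fun j i =>
    (lam : ℂ) * x i ^ (b - w + (j : ℕ)) - ((lam + mud + 1 / t : ℝ) : ℂ) * x i ^ (j : ℕ)

/-- The right-hand side of the linear system; row `j` is `A_{j+1}`. -/
def poolRhs (lam mud t : ℝ) (b w : ℕ) : Fin w → ℂ :=
  fun j => (((j : ℕ) * mud + mud * t * (lam * b - (lam + mud) * w) - mud * w : ℝ) : ℂ)

end

/-! ### Rouché's theorem for polynomials on the unit circle -/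

/-! Write `q = lam + mud + 1/t`. On the unit circle `-q z^w` dominates the other two terms of the
polynomial, because `lam + mud < q`, so Rouché's theorem gives `w` roots in the disk. At a double
root the equations `p = p' = 0` determine two powers of the modulus, and weighted AM-GM then forces
`q ≤ lam + mud`. The matrix of the system is a transposed Vandermonde matrix times an invertible
diagonal one.

For the value function, let `f v = ∑ c_i x_i^v + v + d` for `v ≥ 0` and `f v = 0` for `v < 0`, where
`d` is `t` times the drift of the surplus. It solves the killed resolvent equation `lam f(v+b-w) +
mud f(v-w) - q f(v) = -v/t` for `v ≥ 0`: the root equation settles `v ≥ w` and the linear system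
settles `v < w` (`poolValue_generator`). As `|x_i| < 1`, it grows at most linearly.

That a solution of linear growth must equal the expectation is shown by discretizing time. On a grid
of step `h = 1/n` the surplus is a random walk with Poisson steps, and `⌊T n⌋` is geometric with
ratio `ρ = exp(-h/t)`. The generator equation gives the discounted one-step equation up to
`O(h^2)(1+v)` (`exists_norm_sub_stepMean_le`). Summing along the killed walk with weights `ρ^k`
telescopes, and since `1/(1-ρ)` is of order `1/h`, the total error is `O(h)`
(`IsPoissonSteps.exists_hasSum_killed`). As `n → ∞`, right-continuity of the paths makes the
discretized surplus equal to the true one from some `n` on, for each outcome, and dominated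
convergence concludes. -/

theorem circleIntegral_multiset_sum_inv_sub (s : Multiset ℂ) (hs : ∀ z ∈ s, ‖z‖ ≠ 1) :
    CircleIntegrable (fun z => (s.map fun a => 1 / (z - a)).sum) 0 1 ∧
      (∮ z in C(0, 1), (s.map fun a => 1 / (z - a)).sum)
        = 2 * Real.pi * Complex.I * ((s.filter fun z => ‖z‖ < 1).card : ℂ) := by
  classical
  induction s using Multiset.induction_on with
  | empty => simp [circleIntegral]
  | cons a s ih =>
    obtain ⟨hi, hv⟩ := ih fun z hz => hs z (Multiset.mem_cons_of_mem hz)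
    have ha : ‖a‖ ≠ 1 := hs a (Multiset.mem_cons_self a s)
    have hia : CircleIntegrable (fun z => 1 / (z - a)) 0 1 := by
      simp only [one_div]
      rw [circleIntegrable_sub_inv_iff]
      right
      simpa using ha
    simp only [Multiset.map_cons, Multiset.sum_cons]
    refine ⟨hia.add hi, ?_⟩
    rw [circleIntegral.integral_add hia hi, hv]
    rcases lt_or_gt_of_ne ha with h | h
    · rw [Multiset.filter_cons_of_pos s h, Multiset.card_cons]
      have : (∮ z in C(0, 1), 1 / (z - a)) = 2 * Real.pi * Complex.I := by
        simp only [one_div]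
        exact circleIntegral.integral_sub_inv_of_mem_ball (by simpa using h)
      rw [this]
      push_cast
      ring
    · rw [Multiset.filter_cons_of_neg (p := fun z : ℂ => ‖z‖ < 1) s (not_lt.mpr h.le)]
      have : (∮ z in C(0, 1), 1 / (z - a)) = 0 := by
        refine Complex.circleIntegral_eq_zero_of_differentiable_on_off_countable zero_le_one
          Set.countable_empty ?_ ?_
        · refine continuousOn_const.div (continuousOn_id.sub continuousOn_const) fun z hz => ?_
          rw [sub_ne_zero]
          rintro rfl
          simp at hz
          linarith
        · intro z hz
          refine (differentiableAt_const _).div (differentiableAt_id.sub_const a) ?_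
          rw [sub_ne_zero]
          rintro rfl
          simp at hz
          linarith
      rw [this, zero_add]

/-- Argument principle: over `ℂ` the logarithmic derivative is the sum of `1 / (z - a)` over the
roots `a`. -/
theorem circleIntegral_logDeriv_polynomial (p : ℂ[X]) (hp : ∀ z : ℂ, ‖z‖ = 1 → p.eval z ≠ 0) :
    CircleIntegrable (fun z => p.derivative.eval z / p.eval z) 0 1 ∧
      (∮ z in C(0, 1), p.derivative.eval z / p.eval z)
        = 2 * Real.pi * Complex.I * ((p.roots.filter fun z => ‖z‖ < 1).card : ℂ) := by
  have hr : ∀ z ∈ p.roots, ‖z‖ ≠ 1 := fun z hz h =>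
    hp z h (Polynomial.isRoot_of_mem_roots hz)
  obtain ⟨-, hv⟩ := circleIntegral_multiset_sum_inv_sub p.roots hr
  refine ⟨?_, ?_⟩
  · refine ContinuousOn.circleIntegrable zero_le_one ?_
    exact p.derivative.continuous.continuousOn.div p.continuous.continuousOn
      fun z hz => hp z (by simpa using hz)
  · rw [← hv]
    refine circleIntegral.integral_congr zero_le_one fun z hz => ?_
    exact (IsAlgClosed.splits p).eval_derivative_div_eval_of_ne_zero (hp z (by simpa using hz))

/-- Rouché: on the circle `p / g` stays within distance `1` of `1`, so the principal logarithm of `p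
/ g` is a primitive of the difference of the logarithmic derivatives, whose integral therefore
vanishes. -/
theorem card_roots_filter_eq_of_norm_sub_lt (p g : ℂ[X])
    (h : ∀ z : ℂ, ‖z‖ = 1 → ‖p.eval z - g.eval z‖ < ‖g.eval z‖) :
    (p.roots.filter fun z => ‖z‖ < 1).card = (g.roots.filter fun z => ‖z‖ < 1).card := by
  have hg : ∀ z : ℂ, ‖z‖ = 1 → g.eval z ≠ 0 := fun z hz h0 => by
    have := h z hz
    rw [h0, norm_zero] at this
    exact absurd this (not_lt.mpr (norm_nonneg _))
  have hp : ∀ z : ℂ, ‖z‖ = 1 → p.eval z ≠ 0 := fun z hz h0 => by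
    have := h z hz
    rw [h0, zero_sub, norm_neg] at this
    exact lt_irrefl _ this
  obtain ⟨ip, vp⟩ := circleIntegral_logDeriv_polynomial p hp
  obtain ⟨ig, vg⟩ := circleIntegral_logDeriv_polynomial g hg
  have key : (∮ z in C(0, 1), (p.derivative.eval z / p.eval z
      - g.derivative.eval z / g.eval z)) = 0 := by
    refine circleIntegral.integral_eq_zero_of_hasDerivWithinAt
      (f := fun z => Complex.log (p.eval z / g.eval z)) zero_le_one fun z hz => ?_
    have hz1 : ‖z‖ = 1 := by simpa using hz
    have hgz := hg z hz1
    have hpz := hp z hz1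
    have hs : p.eval z / g.eval z ∈ Complex.slitPlane := by
      have : ‖p.eval z / g.eval z - 1‖ < 1 := by
        rw [div_sub_one hgz, norm_div, div_lt_one (norm_pos_iff.mpr hgz)]
        exact h z hz1
      have h2 := Complex.mem_slitPlane_of_norm_lt_one this
      simpa using h2
    have hd := (((p.hasDerivAt z).div (g.hasDerivAt z) hgz).clog hs).hasDerivWithinAt
      (s := Metric.sphere (0 : ℂ) 1)
    refine hd.congr_deriv ?_
    simp only [Pi.div_apply]
    field_simp
  rw [circleIntegral.integral_sub ip ig, vp, vg, ← mul_sub] at key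
  have h2 : (2 * Real.pi * Complex.I : ℂ) ≠ 0 := Complex.two_pi_I_ne_zero
  have h3 := (mul_eq_zero.mp key).resolve_left h2
  exact_mod_cast sub_eq_zero.mp h3

/-! ### The roots of the pool polynomial -/

section roots

variable {lam mud t : ℝ} {b w : ℕ}

theorem poolPoly_eval (lam mud t : ℝ) (b w : ℕ) (z : ℂ) :
    (poolPoly lam mud t b w).eval z
      = lam * z ^ b - ((lam + mud + 1 / t : ℝ) : ℂ) * z ^ w + mud := by
  simp [poolPoly]

theorem card_diskRoots (hlam : 0 < lam) (hmud : 0 < mud) (ht : 0 < t) :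
    (diskRoots lam mud t b w).card = w := by
  have hq : 0 < lam + mud + 1 / t := by positivity
  rw [diskRoots, card_roots_filter_eq_of_norm_sub_lt _
    (Polynomial.C (-((lam + mud + 1 / t : ℝ) : ℂ)) * Polynomial.X ^ w)]
  · rw [Polynomial.roots_C_mul _ (by rw [neg_ne_zero]; exact_mod_cast hq.ne'),
      Polynomial.roots_X_pow, Multiset.nsmul_singleton,
      Multiset.filter_eq_self.mpr, Multiset.card_replicate]
    intro a ha
    simp [Multiset.eq_of_mem_replicate ha]
  · intro z hz
    rw [poolPoly_eval]
    simp only [Polynomial.eval_mul, Polynomial.eval_C, Polynomial.eval_pow, Polynomial.eval_X]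
    have e : (lam * z ^ b - ((lam + mud + 1 / t : ℝ) : ℂ) * z ^ w + mud)
        - -((lam + mud + 1 / t : ℝ) : ℂ) * z ^ w = lam * z ^ b + mud := by ring
    rw [e, norm_mul, norm_neg, norm_pow, hz, one_pow, mul_one, Complex.norm_real,
      Real.norm_of_nonneg hq.le]
    have := norm_add_le ((lam : ℂ) * z ^ b) (mud : ℂ)
    rw [norm_mul, norm_pow, hz, one_pow, mul_one, Complex.norm_real, Complex.norm_real,
      Real.norm_of_nonneg hlam.le, Real.norm_of_nonneg hmud.le] at this
    have : 0 < 1 / t := by positivity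
    linarith

theorem mem_diskRoots (hlam : 0 < lam) (hmud : 0 < mud) (hw : 0 < w)
    {z : ℂ} (hz : z ∈ diskRoots lam mud t b w) :
    ‖z‖ < 1 ∧ z ≠ 0 ∧
      (lam * z ^ b - ((lam + mud + 1 / t : ℝ) : ℂ) * z ^ w + mud = 0) := by
  rw [diskRoots, Multiset.mem_filter] at hz
  have h := Polynomial.isRoot_of_mem_roots hz.1
  rw [Polynomial.IsRoot, poolPoly_eval] at h
  refine ⟨hz.2, ?_, h⟩
  rintro rfl
  rcases b.eq_zero_or_pos with hb | hb
  · subst hb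
    simp [hw.ne'] at h
    have h2 : lam + mud = 0 := by exact_mod_cast h
    linarith
  · simp [hw.ne', hb.ne'] at h
    exact hmud.ne' h

/-- Weighted arithmetic-geometric mean inequality for the weights `w` and `m`. -/
theorem add_le_mul_inv_pow_add_mul_pow (w m : ℕ) {s : ℝ} (hs : 0 < s) :
    (w + m : ℝ) ≤ w * (s ^ m)⁻¹ + m * s ^ w := by
  -- The inequality `log x ≤ x - 1`, summed with weights `w` and `m`; the weighted logarithms
  -- cancel.
  have key : ∀ x y : ℝ, 0 < x → 0 < y → (w : ℝ) * Real.log x + m * Real.log y = 0 →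
      (w + m : ℝ) ≤ w * x + m * y := by
    intro x y hx hy h
    have h1 := Real.log_le_sub_one_of_pos hx
    have h2 := Real.log_le_sub_one_of_pos hy
    have h3 := mul_le_mul_of_nonneg_left h1 (Nat.cast_nonneg (α := ℝ) w)
    have h4 := mul_le_mul_of_nonneg_left h2 (Nat.cast_nonneg (α := ℝ) m)
    linarith
  refine key _ _ (by positivity) (by positivity) ?_
  rw [Real.log_inv, Real.log_pow, Real.log_pow]
  ring

/-- At a nonzero double root of modulus `r`, `lam b r^(b-w) = q w` and `q (b-w) r^w = mud b`. Hence
`(lam + mud) b = q (w r^(-(b-w)) + (b-w) r^w) ≥ q b` by AM-GM, against `lam + mud < q`. -/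
theorem nodup_diskRoots (hlam : 0 < lam) (hmud : 0 < mud) (ht : 0 < t) (hw : 0 < w)
    (hwb : w < b) : (diskRoots lam mud t b w).Nodup := by
  classical
  set q := lam + mud + 1 / t with hqdef
  have hqpos : 0 < q := by positivity
  have hq : lam + mud < q := by
    have : 0 < 1 / t := by positivity
    linarith
  -- Here `b = w + m + 1`, so that `b - w` is `m + 1`.
  obtain ⟨m, rfl⟩ := Nat.exists_eq_add_of_lt hwb
  rw [Multiset.nodup_iff_count_le_one]
  intro z
  by_contra! hc
  have hz : z ∈ diskRoots lam mud t (w + m + 1) w := Multiset.count_pos.mp (by omega)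
  obtain ⟨hz1, hz0, hpz⟩ := mem_diskRoots hlam hmud hw hz
  have hc' : 1 < (poolPoly lam mud t (w + m + 1) w).rootMultiplicity z := by
    rw [← Polynomial.count_roots]
    exact hc.trans_le (Multiset.count_le_of_le _ (Multiset.filter_le _ _))
  have hp0 : poolPoly lam mud t (w + m + 1) w ≠ 0 := by
    intro h
    simp [h] at hc'
  have hd := ((Polynomial.one_lt_rootMultiplicity_iff_isRoot hp0).mp hc').2
  have hd' : (lam : ℂ) * ((w + m + 1 : ℕ) * z ^ (w + m)) - (q : ℂ) * (w * z ^ (w - 1)) = 0 := by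
    simpa [Polynomial.IsRoot, poolPoly, hqdef, Polynomial.derivative_X_pow] using hd
  have hd2 : (lam : ℂ) * (w + m + 1 : ℕ) * z ^ (m + 1) = q * w := by
    have hz' : z ^ (w - 1) ≠ 0 := pow_ne_zero _ hz0
    apply mul_right_cancel₀ hz'
    have e : w + m = (m + 1) + (w - 1) := by omega
    rw [e, pow_add] at hd'
    rw [show ((w + m + 1 : ℕ) : ℂ) = (((m + 1) + (w - 1) + 1 : ℕ) : ℂ) by
      congr 1; omega]
    linear_combination hd'
  have hp2 : (q : ℂ) * (m + 1 : ℕ) * z ^ w = mud * (w + m + 1 : ℕ) := by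
    have e : w + m + 1 = (m + 1) + w := by omega
    have hpz' : (lam : ℂ) * (z ^ (m + 1) * z ^ w) - q * z ^ w + mud = 0 := by
      rw [← pow_add, ← e]; exact hpz
    push_cast at hd2 ⊢
    linear_combination z ^ w * hd2 - (w + m + 1) * hpz'
  set r := ‖z‖ with hr
  have hr0 : 0 < r := norm_pos_iff.mpr hz0
  have n1 : lam * (w + m + 1 : ℕ) * r ^ (m + 1) = q * w := by
    have := congrArg norm hd2
    rwa [norm_mul, norm_mul, norm_mul, norm_pow, Complex.norm_natCast, Complex.norm_natCast,
      Complex.norm_real, Complex.norm_real, Real.norm_of_nonneg hlam.le,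
      Real.norm_of_nonneg hqpos.le] at this
  have n2 : q * (m + 1 : ℕ) * r ^ w = mud * (w + m + 1 : ℕ) := by
    have := congrArg norm hp2
    rwa [norm_mul, norm_mul, norm_mul, norm_pow, Complex.norm_natCast, Complex.norm_natCast,
      Complex.norm_real, Complex.norm_real, Real.norm_of_nonneg hmud.le,
      Real.norm_of_nonneg hqpos.le] at this
  have ag := add_le_mul_inv_pow_add_mul_pow w (m + 1) hr0
  have hb : (0 : ℝ) < (w + m + 1 : ℕ) := by positivity
  have n1' : lam * (w + m + 1 : ℕ) = q * (w * (r ^ (m + 1))⁻¹) := by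
    rw [← mul_assoc, ← n1]
    field_simp
  have : q * (w + m + 1 : ℕ) ≤ (lam + mud) * (w + m + 1 : ℕ) := by
    rw [add_mul lam mud, n1', ← n2]
    have := mul_le_mul_of_nonneg_left ag hqpos.le
    push_cast at this ⊢
    linarith
  have := le_of_mul_le_mul_right this hb
  linarith

theorem injective_of_map_eq_diskRoots (hlam : 0 < lam) (hmud : 0 < mud) (ht : 0 < t) (hw : 0 < w)
    (hwb : w < b) {x : Fin w → ℂ} (hx : Finset.univ.val.map x = diskRoots lam mud t b w) :
    Function.Injective x := by
  have := nodup_diskRoots hlam hmud ht hw hwb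
  rw [← hx] at this
  intro i j hij
  exact Multiset.inj_on_of_nodup_map this i (Finset.mem_univ i) j (Finset.mem_univ j) hij

/-- Column `i` is `lam x_i^(b-w) - q` times a Vandermonde column. This factor is nonzero, since its
product with `x_i^w` is `-mud`. -/
theorem existsUnique_poolMatrix (hlam : 0 < lam) (hmud : 0 < mud) (ht : 0 < t) (hw : 0 < w)
    (hwb : w < b) {x : Fin w → ℂ} (hx : Finset.univ.val.map x = diskRoots lam mud t b w)
    (y : Fin w → ℂ) :
    ∃! c : Fin w → ℂ, (poolMatrix lam mud t b w x).mulVec c = y := by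
  have hinj := injective_of_map_eq_diskRoots hlam hmud ht hw hwb hx
  have hM : poolMatrix lam mud t b w x = (Matrix.vandermonde x).transpose *
      Matrix.diagonal fun i => lam * x i ^ (b - w) - ((lam + mud + 1 / t : ℝ) : ℂ) := by
    ext j i
    rw [Matrix.mul_diagonal]
    simp only [poolMatrix, Matrix.of_apply, Matrix.transpose_apply, Matrix.vandermonde_apply]
    rw [pow_add]
    ring
  have hdet : IsUnit (poolMatrix lam mud t b w x).det := by
    rw [hM, Matrix.det_mul, Matrix.det_transpose, Matrix.det_diagonal, isUnit_iff_ne_zero]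
    refine mul_ne_zero (Matrix.det_vandermonde_ne_zero_iff.mpr hinj)
      (Finset.prod_ne_zero_iff.mpr fun i _ h => ?_)
    have hi : x i ∈ diskRoots lam mud t b w := by
      rw [← hx]
      exact Multiset.mem_map_of_mem x (Finset.mem_univ i)
    obtain ⟨-, -, hp⟩ := mem_diskRoots hlam hmud hw hi
    have e : x i ^ b = x i ^ (b - w) * x i ^ w := by
      rw [← pow_add, Nat.sub_add_cancel hwb.le]
    rw [e] at hp
    have : (mud : ℂ) = 0 := by linear_combination hp - x i ^ w * h
    exact hmud.ne' (by exact_mod_cast this)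
  refine ⟨(poolMatrix lam mud t b w x)⁻¹.mulVec y, ?_, ?_⟩
  · simp only [Matrix.mulVec_mulVec, Matrix.mul_nonsing_inv _ hdet, Matrix.one_mulVec]
  · rintro c rfl
    rw [Matrix.mulVec_mulVec, Matrix.nonsing_inv_mul _ hdet, Matrix.one_mulVec]

end roots

/-! ### The candidate value function -/

/-- The function `v ↦ ∑ i, c i * x i ^ v + v + d` on the nonnegative integers, extended by zero. -/
noncomputable def poolValue {w : ℕ} (c x : Fin w → ℂ) (d : ℂ) (v : ℤ) : ℂ :=
  if 0 ≤ v then (∑ i, c i * x i ^ v.toNat) + v + d else 0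

theorem poolValue_natCast {w : ℕ} (c x : Fin w → ℂ) (d : ℂ) (n : ℕ) :
    poolValue c x d n = (∑ i, c i * x i ^ n) + n + d := by
  simp [poolValue]

theorem poolValue_of_neg {w : ℕ} (c x : Fin w → ℂ) (d : ℂ) {v : ℤ} (hv : v < 0) :
    poolValue c x d v = 0 := by
  simp [poolValue, hv.not_ge]

/-- Roots in the disk keep the powers bounded; the resulting linear growth is what makes the later
sums and means converge. -/
theorem exists_norm_poolValue_le {w : ℕ} (c x : Fin w → ℂ) (d : ℂ) (hx : ∀ i, ‖x i‖ < 1) :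
    ∃ C : ℝ, 0 ≤ C ∧ ∀ v : ℤ, 0 ≤ v → ‖poolValue c x d v‖ ≤ C * (1 + v) := by
  refine ⟨(∑ i, ‖c i‖) + 1 + ‖d‖, by positivity, fun v hv => ?_⟩
  lift v to ℕ using hv
  rw [poolValue_natCast]
  have h1 : ‖∑ i, c i * x i ^ v‖ ≤ ∑ i, ‖c i‖ := by
    refine (norm_sum_le _ _).trans (Finset.sum_le_sum fun i _ => ?_)
    rw [norm_mul, norm_pow]
    exact mul_le_of_le_one_right (norm_nonneg _) (pow_le_one₀ (norm_nonneg _) (hx i).le)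
  have h2 : ‖(∑ i, c i * x i ^ v) + v + d‖ ≤ (∑ i, ‖c i‖) + v + ‖d‖ := by
    refine (norm_add_le _ _).trans (add_le_add_left ((norm_add_le _ _).trans ?_) _)
    rw [Complex.norm_natCast]
    exact add_le_add_left h1 _
  have h3 : 0 ≤ ((∑ i, ‖c i‖) + ‖d‖) * v := by positivity
  push_cast
  nlinarith

/-- The affine part `v + d` solves the unkilled equation because `d / t` is the drift `lam (b-w) -
mud w`. The powers must then solve the homogeneous equation, with a boundary correction for `v < w`.
-/
theorem poolValue_generator {lam mud t : ℝ} {b w : ℕ} (hlam : 0 < lam) (hmud : 0 < mud)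
    (ht : 0 < t) (hw : 0 < w) (hwb : w < b) {c x : Fin w → ℂ}
    (hx : ∀ i, x i ∈ diskRoots lam mud t b w)
    (hc : (poolMatrix lam mud t b w x).mulVec c = poolRhs lam mud t b w)
    {d : ℂ} (hd : d = lam * b * t - (lam + mud) * w * t) {v : ℤ} (hv : 0 ≤ v) :
    lam * poolValue c x d (v + (b - w : ℕ)) + mud * poolValue c x d (v - w)
      - ((lam + mud + 1 / t : ℝ) : ℂ) * poolValue c x d v = - (v / t) := by
  have htc : (t : ℂ) ≠ 0 := by exact_mod_cast ht.ne'
  lift v to ℕ using hv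
  rw [← Nat.cast_add, poolValue_natCast, poolValue_natCast]
  -- From `v < w` one downward move is ruinous, so `f (v - w) = 0` and the identity is row `v` of
  -- the linear system, counted from `0`.
  by_cases hvw : v < w
  · rw [poolValue_of_neg _ _ _ (by omega)]
    have hj := congrFun hc ⟨v, hvw⟩
    simp only [Matrix.mulVec, dotProduct, poolMatrix, Matrix.of_apply, poolRhs] at hj
    have e : ∑ i, ((lam : ℂ) * x i ^ (b - w + v) - ((lam + mud + 1 / t : ℝ) : ℂ) * x i ^ v) * c i
        = lam * (∑ i, c i * x i ^ (v + (b - w)))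
          - ((lam + mud + 1 / t : ℝ) : ℂ) * ∑ i, c i * x i ^ v := by
      rw [Finset.mul_sum, Finset.mul_sum, ← Finset.sum_sub_distrib]
      refine Finset.sum_congr rfl fun i _ => ?_
      rw [add_comm (b - w) v]
      ring
    rw [e] at hj
    push_cast [hwb.le] at hj ⊢
    rw [hd]
    field_simp
    field_simp at hj
    linear_combination hj
  · rw [not_lt] at hvw
    rw [← Nat.cast_sub hvw, poolValue_natCast]
    -- Each summand is `c i * x i ^ (v - w)` times the root equation.
    have e : (lam : ℂ) * (∑ i, c i * x i ^ (v + (b - w))) + mud * (∑ i, c i * x i ^ (v - w))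
        - ((lam + mud + 1 / t : ℝ) : ℂ) * ∑ i, c i * x i ^ v = 0 := by
      rw [Finset.mul_sum, Finset.mul_sum, Finset.mul_sum, ← Finset.sum_add_distrib,
        ← Finset.sum_sub_distrib]
      refine Finset.sum_eq_zero fun i _ => ?_
      obtain ⟨-, -, hp⟩ := mem_diskRoots hlam hmud hw (hx i)
      have e1 : v + (b - w) = (v - w) + b := by omega
      have e2 : x i ^ v = x i ^ (v - w) * x i ^ w := by rw [← pow_add, Nat.sub_add_cancel hvw]
      rw [e1, pow_add, e2]
      linear_combination c i * x i ^ (v - w) * hp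
    push_cast [hwb.le, hvw] at e ⊢
    rw [hd]
    field_simp
    field_simp at e
    linear_combination e

/-! ### One step of the discretized surplus process -/

theorem hasSum_natCast_mul_pow_div_factorial (r : ℝ) :
    HasSum (fun n : ℕ => (n : ℝ) * (r ^ n / n.factorial)) (r * Real.exp r) := by
  rw [← hasSum_nat_add_iff' 1]
  have h := (NormedSpace.expSeries_div_hasSum_exp r).mul_left r
  rw [← Real.exp_eq_exp_ℝ] at h
  simp only [Finset.range_one, Finset.sum_singleton, Nat.cast_zero, zero_mul, sub_zero]
  convert! h using 2 with n
  rw [Nat.factorial_succ]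
  have : (n.factorial : ℝ) ≠ 0 := by positivity
  push_cast
  field_simp
  ring

theorem integrable_natCast_poissonMeasure (r : ℝ≥0) :
    Integrable (fun n : ℕ => (n : ℝ)) (poissonMeasure r) := by
  rw [integrable_poissonMeasure_iff]
  refine ((hasSum_natCast_mul_pow_div_factorial r).summable.mul_left (Real.exp (-r))).congr
    fun n => ?_
  rw [Real.norm_of_nonneg (Nat.cast_nonneg n)]
  ring

theorem integral_natCast_poissonMeasure (r : ℝ≥0) :
    ∫ n : ℕ, (n : ℝ) ∂(poissonMeasure r) = r := by
  refine (hasSum_integral_poissonMeasure (integrable_natCast_poissonMeasure r)).unique ?_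
  have h := (hasSum_natCast_mul_pow_div_factorial r).mul_left (Real.exp (-r))
  have e : Real.exp (-r) * (r * Real.exp r) = (r : ℝ) := by
    rw [mul_left_comm, ← Real.exp_add, neg_add_cancel, Real.exp_zero, mul_one]
  rw [e] at h
  convert! h using 2 with n
  rw [smul_eq_mul]
  ring

/-- Functions on `ℤ` that vanish on the negative integers and grow at most linearly. -/
structure LinearGrowth (C : ℝ) (f : ℤ → ℂ) : Prop where
  nonneg : 0 ≤ C
  of_neg : ∀ v < 0, f v = 0
  norm_le : ∀ v, 0 ≤ v → ‖f v‖ ≤ C * (1 + v)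

/-- Downward moves only decrease the bound or lead to a zero of `f`, so the estimate involves the
upward count alone. -/
theorem LinearGrowth.norm_add_sub_le {C : ℝ} {f : ℤ → ℂ} (hf : LinearGrowth C f) (m w : ℕ)
    {v : ℤ} (hv : 0 ≤ v) (a k : ℕ) :
    ‖f (v + m * a - w * k)‖ ≤ C * (1 + v) * (1 + m * a) := by
  have hC := hf.nonneg
  have hv' : (0 : ℝ) ≤ v := by exact_mod_cast hv
  rcases lt_or_ge (v + m * a - w * k) 0 with h | h
  · rw [hf.of_neg _ h, norm_zero]
    positivity
  · refine (hf.norm_le _ h).trans ?_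
    rw [mul_assoc]
    refine mul_le_mul_of_nonneg_left ?_ hC
    push_cast
    have h1 : (0 : ℝ) ≤ (v : ℝ) * (m * a) := by positivity
    have h2 : (0 : ℝ) ≤ (w : ℝ) * k := by positivity
    nlinarith

/-- The mean of `f` after one step from `v`: up by `m` for each point of a Poisson variable of mean
`α`, down by `w` for each point of an independent Poisson variable of mean `β`. -/
noncomputable def stepMean (m w : ℕ) (α β : ℝ≥0) (f : ℤ → ℂ) (v : ℤ) : ℂ :=
  ∫ p : ℕ × ℕ, f (v + m * p.1 - w * p.2) ∂((poissonMeasure α).prod (poissonMeasure β))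

theorem LinearGrowth.integrable_step {C : ℝ} {f : ℤ → ℂ} (hf : LinearGrowth C f) (m w : ℕ)
    (α β : ℝ≥0) {v : ℤ} (hv : 0 ≤ v) :
    Integrable (fun p : ℕ × ℕ => f (v + m * p.1 - w * p.2))
      ((poissonMeasure α).prod (poissonMeasure β)) := by
  refine Integrable.mono' (g := fun p : ℕ × ℕ => C * (1 + v) * (1 + m * (p.1 : ℝ))) ?_
    (Measurable.of_discrete).aestronglyMeasurable
    (ae_of_all _ fun p => hf.norm_add_sub_le m w hv p.1 p.2)
  exact (((integrable_const 1).add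
    (((integrable_natCast_poissonMeasure α).comp_fst _).const_mul _)).const_mul _)

/-- The weights of the power series in the step size of the discounted mean over one step. -/
noncomputable def stepWeight (lam mud : ℝ) (p : ℕ × ℕ) : ℝ :=
  lam ^ p.1 / p.1.factorial * (mud ^ p.2 / p.2.factorial)

theorem summable_stepWeight_mul {lam mud : ℝ} (hlam : 0 ≤ lam) (hmud : 0 ≤ mud) (m : ℕ) :
    Summable fun p : ℕ × ℕ => (1 + m * (p.1 : ℝ)) * stepWeight lam mud p := by
  have h1 : Summable fun n : ℕ => (1 + m * (n : ℝ)) * (lam ^ n / n.factorial) := by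
    refine ((NormedSpace.expSeries_div_summable lam).add
      ((hasSum_natCast_mul_pow_div_factorial lam).summable.mul_left (m : ℝ))).congr fun n => ?_
    ring
  have h2 : Summable fun n : ℕ => mud ^ n / (n.factorial : ℝ) :=
    NormedSpace.expSeries_div_summable mud
  refine (h1.mul_of_nonneg h2 (fun n => by positivity) fun n => by positivity).congr fun p => ?_
  rw [stepWeight]
  ring

theorem hasSum_integral_of_countable {α : Type*} [MeasurableSpace α] [Countable α]
    [MeasurableSingletonClass α] {μ : Measure α} {f : α → ℂ} (hf : Integrable f μ) :
    HasSum (fun x => μ.real {x} • f x) (∫ x, f x ∂μ) := by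
  have h := hf
  rw [← Measure.sum_smul_dirac μ] at h
  simpa [Measure.sum_smul_dirac, measureReal_def] using hasSum_integral_measure h

theorem hasSum_stepMean {lam mud h C : ℝ} (hlam : 0 ≤ lam) (hmud : 0 ≤ mud) (hh : 0 ≤ h)
    {f : ℤ → ℂ} (hf : LinearGrowth C f) (m w : ℕ) {v : ℤ} (hv : 0 ≤ v) :
    HasSum (fun p : ℕ × ℕ => ((Real.exp (-(lam + mud) * h) * h ^ (p.1 + p.2)
        * stepWeight lam mud p : ℝ) : ℂ) * f (v + m * p.1 - w * p.2))
      (stepMean m w (lam * h).toNNReal (mud * h).toNNReal f v) := by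
  have hi := hf.integrable_step m w (lam * h).toNNReal (mud * h).toNNReal hv
  rw [stepMean]
  convert! hasSum_integral_of_countable hi using 2 with p
  have e : ({p} : Set (ℕ × ℕ)) = {p.1} ×ˢ {p.2} := by simp
  rw [e, measureReal_prod_prod, poissonMeasure_real_singleton, poissonMeasure_real_singleton,
    Real.coe_toNNReal _ (by positivity), Real.coe_toNNReal _ (by positivity), Complex.real_smul,
    stepWeight, neg_add, add_mul, Real.exp_add, pow_add, mul_pow, mul_pow]
  congr 2
  simp only [neg_mul]
  ring

/-! ### Expansion of the one-step mean in the step size -/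

theorem abs_exp_neg_sub_one_le {x : ℝ} (hx : 0 ≤ x) : |Real.exp (-x) - 1| ≤ x := by
  have h1 := Real.add_one_le_exp (-x)
  have h2 : Real.exp (-x) ≤ 1 := Real.exp_le_one_iff.mpr (by linarith)
  rw [abs_le]
  constructor <;> linarith

theorem abs_exp_neg_sub_one_add_le {x : ℝ} (hx : 0 ≤ x) : |Real.exp (-x) - 1 + x| ≤ x ^ 2 := by
  have h1 := Real.add_one_le_exp (-x)
  have h2 := Real.add_one_le_exp x
  have h3 : Real.exp (-x) * Real.exp x = 1 := by rw [← Real.exp_add, neg_add_cancel, Real.exp_zero]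
  have h4 := Real.exp_pos (-x)
  rw [abs_le]
  constructor
  · nlinarith
  · have h5 : Real.exp (-x) * (x + 1) ≤ 1 := by
      calc _ ≤ Real.exp (-x) * Real.exp x := mul_le_mul_of_nonneg_left h2 h4.le
        _ = 1 := h3
    have h6 : (Real.exp (-x) - 1 + x) * (x + 1) ≤ x ^ 2 * (x + 1) := by nlinarith [pow_nonneg hx 3]
    exact le_of_mul_le_mul_right h6 (by linarith)

/-- First-order expansion in the step size of the discounted mean over one step. -/
theorem exists_norm_stepMean_sub_le {lam mud q C : ℝ} (hlam : 0 ≤ lam) (hmud : 0 ≤ mud)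
    (hq : lam + mud ≤ q) {f : ℤ → ℂ} (hf : LinearGrowth C f) (m w : ℕ) :
    ∃ K : ℝ, 0 ≤ K ∧ ∀ h : ℝ, 0 < h → h ≤ 1 → ∀ v : ℤ, 0 ≤ v →
      ‖(Real.exp (-(q - lam - mud) * h) : ℂ)
          * stepMean m w (lam * h).toNNReal (mud * h).toNNReal f v
        - f v - h * (lam * f (v + m) + mud * f (v - w) - q * f v)‖ ≤ K * h ^ 2 * (1 + v) := by
  have hC := hf.nonneg
  have hq0 : 0 ≤ q := by linarith
  set G : ℕ × ℕ → ℝ := fun p => (1 + m * (p.1 : ℝ)) * stepWeight lam mud p with hG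
  have hGs : Summable G := summable_stepWeight_mul hlam hmud m
  have hG0 : ∀ p, 0 ≤ G p := fun p => by
    rw [hG]
    simp only [stepWeight]
    positivity
  set S := ∑' p, G p with hS
  have hS0 : 0 ≤ S := tsum_nonneg hG0
  have hGS : ∀ p, G p ≤ S := fun p => hGs.le_tsum p fun j _ => hG0 j
  -- The `1` comes from the terms with at least two jumps, `q ^ 2` from `r - 1 + q h`, and `2 q`
  -- from `r - 1` times the two single-jump terms.
  refine ⟨C * S * (q ^ 2 + 2 * q + 1), by positivity, fun h hh0 hh1 v hv => ?_⟩
  have hv' : (0 : ℝ) ≤ v := by exact_mod_cast hv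
  set g : ℕ × ℕ → ℂ := fun p => (stepWeight lam mud p : ℂ) * f (v + m * p.1 - w * p.2) with hg
  have hgG : ∀ p, ‖g p‖ ≤ C * (1 + v) * G p := fun p => by
    have h1 := hf.norm_add_sub_le m w hv p.1 p.2
    have h2 : 0 ≤ stepWeight lam mud p := by
      simp only [stepWeight]
      positivity
    rw [hg, hG]
    simp only
    rw [norm_mul, Complex.norm_real, Real.norm_of_nonneg h2]
    calc _ ≤ stepWeight lam mud p * (C * (1 + v) * (1 + m * p.1)) :=
          mul_le_mul_of_nonneg_left h1 h2
      _ = _ := by ring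
  have hgS : ∀ p, ‖g p‖ ≤ C * (1 + v) * S := fun p =>
    (hgG p).trans (mul_le_mul_of_nonneg_left (hGS p) (by positivity))
  set r := Real.exp (-(q * h)) with hr
  -- Multiplying by `exp ((lam + mud) h)` cancels the Poisson normalization and leaves a power
  -- series in `h`.
  have hsum : HasSum (fun p : ℕ × ℕ => (h : ℂ) ^ (p.1 + p.2) * g p)
      (Real.exp ((lam + mud) * h) * stepMean m w (lam * h).toNNReal (mud * h).toNNReal f v) := by
    have h1 := (hasSum_stepMean hlam hmud hh0.le hf m w hv).mul_left
      ((Real.exp ((lam + mud) * h) : ℝ) : ℂ)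
    convert! h1 using 2 with p
    have h2 : Real.exp ((lam + mud) * h) * Real.exp (-(lam + mud) * h) = 1 := by
      rw [← Real.exp_add, ← Real.exp_zero]
      congr 1
      ring
    have h3 : (Real.exp ((lam + mud) * h) : ℂ) * (Real.exp (-(lam + mud) * h) : ℂ) = 1 := by
      exact_mod_cast h2
    rw [hg]
    simp only [Complex.ofReal_mul, Complex.ofReal_pow]
    linear_combination (-((h : ℂ) ^ (p.1 + p.2) * (stepWeight lam mud p)
      * f (v + m * p.1 - w * p.2))) * h3
  set E : ℂ := Real.exp ((lam + mud) * h)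
    * stepMean m w (lam * h).toNNReal (mud * h).toNNReal f v with hE
  -- These are the pairs of total degree at most one; since `h ≤ 1`, every other term carries a
  -- factor at most `h ^ 2`.
  let s : Finset (ℕ × ℕ) := {(0, 0), (1, 0), (0, 1)}
  have hrem : ‖E - (g (0, 0) + h * (g (1, 0) + g (0, 1)))‖ ≤ h ^ 2 * (C * (1 + v)) * S := by
    have h1 : HasSum (fun p => if p ∈ s then (h : ℂ) ^ (p.1 + p.2) * g p else 0)
        (g (0, 0) + h * (g (1, 0) + g (0, 1))) := by
      have h2 : ∑ p ∈ s, (if p ∈ s then (h : ℂ) ^ (p.1 + p.2) * g p else 0)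
          = g (0, 0) + h * (g (1, 0) + g (0, 1)) := by
        rw [Finset.sum_congr rfl fun p hp => if_pos hp]
        simp [s]
        ring
      rw [← h2]
      exact hasSum_sum_of_ne_finset_zero fun p hp => if_neg hp
    refine (hsum.sub h1).norm_le_of_bounded (hGs.hasSum.mul_left (h ^ 2 * (C * (1 + v))))
      fun p => ?_
    by_cases hp : p ∈ s
    · rw [if_pos hp, sub_self, norm_zero]
      have := hG0 p
      positivity
    · rw [if_neg hp, sub_zero, norm_mul, norm_pow, Complex.norm_real, Real.norm_of_nonneg hh0.le,
        mul_assoc]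
      have h2 : 2 ≤ p.1 + p.2 := by
        by_contra! h3
        apply hp
        obtain ⟨a, k⟩ := p
        simp only [s, Finset.mem_insert, Finset.mem_singleton, Prod.mk.injEq]
        simp only at h3
        omega
      exact mul_le_mul (pow_le_pow_of_le_one hh0.le hh1 h2) (hgG p) (norm_nonneg _) (by positivity)
  have e00 : g (0, 0) = f v := by simp [hg, stepWeight]
  have e10 : g (1, 0) = lam * f (v + m) := by simp [hg, stepWeight]
  have e01 : g (0, 1) = mud * f (v - w) := by simp [hg, stepWeight]
  rw [e00, e10, e01] at hrem
  have n00 := hgS (0, 0)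
  have n10 := hgS (1, 0)
  have n01 := hgS (0, 1)
  rw [e00] at n00
  rw [e10] at n10
  rw [e01] at n01
  set U := f v
  set D := (lam : ℂ) * f (v + m)
  set D' := (mud : ℂ) * f (v - w)
  have hr0 : 0 < r := Real.exp_pos _
  have hr1 : r ≤ 1 := Real.exp_le_one_iff.mpr (by nlinarith)
  have hstep : (Real.exp (-(q - lam - mud) * h) : ℂ)
      * stepMean m w (lam * h).toNNReal (mud * h).toNNReal f v = r * E := by
    have h1 : Real.exp (-(q - lam - mud) * h) = r * Real.exp ((lam + mud) * h) := by
      rw [hr, ← Real.exp_add]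
      congr 1
      ring
    rw [hE, ← mul_assoc, ← Complex.ofReal_mul, ← h1]
  rw [hstep]
  have hdecomp : r * E - U - h * (D + D' - q * U)
      = r * (E - (U + h * (D + D'))) + ((r - 1 + q * h : ℝ) : ℂ) * U
        + ((r - 1 : ℝ) : ℂ) * (h * (D + D')) := by
    push_cast
    ring
  rw [hdecomp]
  have b1 : ‖(r : ℂ) * (E - (U + h * (D + D')))‖ ≤ h ^ 2 * (C * (1 + v)) * S := by
    rw [norm_mul, Complex.norm_real, Real.norm_of_nonneg hr0.le]
    exact (mul_le_of_le_one_left (norm_nonneg _) hr1).trans hrem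
  have b2 : ‖((r - 1 + q * h : ℝ) : ℂ) * U‖ ≤ (q * h) ^ 2 * (C * (1 + v) * S) := by
    rw [norm_mul, Complex.norm_real]
    exact mul_le_mul (abs_exp_neg_sub_one_add_le (by positivity)) n00 (norm_nonneg _)
      (by positivity)
  have b3 : ‖((r - 1 : ℝ) : ℂ) * (h * (D + D'))‖ ≤ (q * h) * (h * (2 * (C * (1 + v) * S))) := by
    rw [norm_mul, norm_mul, Complex.norm_real, Complex.norm_real, Real.norm_of_nonneg hh0.le]
    refine mul_le_mul (abs_exp_neg_sub_one_le (by positivity)) ?_ (by positivity) (by positivity)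
    refine mul_le_mul_of_nonneg_left ((norm_add_le _ _).trans ?_) hh0.le
    linarith
  calc _ ≤ _ := norm_add₃_le
    _ ≤ _ := add_le_add_three b1 b2 b3
    _ = _ := by ring

/-- A solution of the generator equation nearly solves its time-discretized version. -/
theorem exists_norm_sub_stepMean_le {lam mud t C : ℝ} (hlam : 0 ≤ lam) (hmud : 0 ≤ mud)
    (ht : 0 < t) {f : ℤ → ℂ} (hf : LinearGrowth C f) (m w : ℕ)
    (hgen : ∀ v : ℤ, 0 ≤ v → lam * f (v + m) + mud * f (v - w)
      - ((lam + mud + 1 / t : ℝ) : ℂ) * f v = - (v / t)) :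
    ∃ K : ℝ, 0 ≤ K ∧ ∀ h : ℝ, 0 < h → h ≤ 1 → ∀ v : ℤ, 0 ≤ v →
      ‖f v - (Real.exp (-(h / t)) : ℂ)
          * stepMean m w (lam * h).toNNReal (mud * h).toNNReal f v
        - ((1 - Real.exp (-(h / t)) : ℝ) : ℂ) * v‖ ≤ K * h ^ 2 * (1 + v) := by
  have ht' : 0 < 1 / t := by positivity
  obtain ⟨K, hK, hb⟩ := exists_norm_stepMean_sub_le hlam hmud
    (q := lam + mud + 1 / t) (by linarith) hf m w
  -- The extra `(1 / t) ^ 2` pays for replacing the source `(h / t) v` by `(1 - exp (-(h / t))) v`.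
  refine ⟨K + (1 / t) ^ 2, by positivity, fun h hh0 hh1 v hv => ?_⟩
  have hv' : (0 : ℝ) ≤ v := by exact_mod_cast hv
  have h1 := hb h hh0 hh1 v hv
  rw [hgen v hv] at h1
  have e : -(lam + mud + 1 / t - lam - mud) * h = -(h / t) := by ring
  rw [e] at h1
  set A := (Real.exp (-(h / t)) : ℂ) * stepMean m w (lam * h).toNNReal (mud * h).toNNReal f v
  have h2 : ‖((Real.exp (-(h / t)) - 1 + h / t : ℝ) : ℂ) * v‖ ≤ (h / t) ^ 2 * v := by
    rw [norm_mul, Complex.norm_real, Complex.norm_intCast, abs_of_nonneg hv']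
    exact mul_le_mul_of_nonneg_right (abs_exp_neg_sub_one_add_le (by positivity)) hv'
  have h3 : f v - A - ((1 - Real.exp (-(h / t)) : ℝ) : ℂ) * v
      = ((Real.exp (-(h / t)) - 1 + h / t : ℝ) : ℂ) * v - (A - f v - h * -((v : ℂ) / t)) := by
    push_cast
    ring
  rw [h3]
  refine (norm_sub_le _ _).trans ((add_le_add h2 h1).trans ?_)
  have h4 : (h / t) ^ 2 * v = (1 / t) ^ 2 * h ^ 2 * v := by ring
  have h5 : 0 ≤ (1 / t) ^ 2 * h ^ 2 := by positivity
  rw [h4]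
  nlinarith

/-! ### Random walks killed below zero -/

/-- The walk from `u` that moves up by `m` per unit of `a i` and down by `w` per unit of `y i`. -/
def walk (m w : ℕ) (u : ℤ) (s : (ℕ → ℕ) × (ℕ → ℕ)) (k : ℕ) : ℤ :=
  u + m * ∑ i ∈ Finset.range k, (s.1 i : ℤ) - w * ∑ i ∈ Finset.range k, (s.2 i : ℤ)

/-- The value of `f` at the position of the walk after `k` steps, or `0` if the walk has been
negative by then. -/
def killed (m w : ℕ) (u : ℤ) (f : ℤ → ℂ) (s : (ℕ → ℕ) × (ℕ → ℕ)) (k : ℕ) : ℂ :=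
  if ∀ j ≤ k, 0 ≤ walk m w u s j then f (walk m w u s k) else 0

theorem walk_zero (m w : ℕ) (u : ℤ) (s : (ℕ → ℕ) × (ℕ → ℕ)) : walk m w u s 0 = u := by
  simp [walk]

theorem walk_succ (m w : ℕ) (u : ℤ) (s : (ℕ → ℕ) × (ℕ → ℕ)) (k : ℕ) :
    walk m w u s (k + 1) = walk m w u s k + m * s.1 k - w * s.2 k := by
  simp only [walk, Finset.sum_range_succ]
  ring

theorem walk_congr (m w : ℕ) (u : ℤ) {s s' : (ℕ → ℕ) × (ℕ → ℕ)} {k : ℕ}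
    (h : ∀ i < k, s.1 i = s'.1 i ∧ s.2 i = s'.2 i) : walk m w u s k = walk m w u s' k := by
  simp only [walk]
  rw [Finset.sum_congr rfl fun i hi => by rw [(h i (Finset.mem_range.mp hi)).1],
    Finset.sum_congr (s₁ := Finset.range k) (f := fun i => (s.2 i : ℤ)) rfl
      fun i hi => by rw [(h i (Finset.mem_range.mp hi)).2]]

theorem killed_congr (m w : ℕ) (u : ℤ) (f : ℤ → ℂ) {s s' : (ℕ → ℕ) × (ℕ → ℕ)} {k : ℕ}
    (h : ∀ i < k, s.1 i = s'.1 i ∧ s.2 i = s'.2 i) :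
    killed m w u f s k = killed m w u f s' k := by
  have h2 : ∀ j ≤ k, walk m w u s j = walk m w u s' j := fun j hj =>
    walk_congr m w u fun i hi => h i (hi.trans_le hj)
  simp only [killed]
  rw [h2 k le_rfl]
  congr 1
  exact propext (forall₂_congr fun j hj => by rw [h2 j hj])

/-- Because `f` vanishes on negative integers, the survival test at the last step is redundant and
can be absorbed into `f`. -/
theorem killed_succ (m w : ℕ) (u : ℤ) {f : ℤ → ℂ} (hf : ∀ v < 0, f v = 0)
    (s : (ℕ → ℕ) × (ℕ → ℕ)) (k : ℕ) :
    killed m w u f s (k + 1)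
      = killed m w u (fun v => f (v + m * s.1 k - w * s.2 k)) s k := by
  simp only [killed]
  rw [← walk_succ]
  by_cases h : ∀ j ≤ k, 0 ≤ walk m w u s j
  · rw [if_pos h]
    by_cases h2 : 0 ≤ walk m w u s (k + 1)
    · rw [if_pos fun j hj => ?_]
      rcases Nat.le_succ_iff.mp hj with h3 | rfl
      · exact h j h3
      · exact h2
    · rw [if_neg fun h3 => h2 (h3 _ le_rfl), hf _ (not_le.mp h2)]
  · rw [if_neg h, if_neg fun h3 => h fun j hj => h3 j (hj.trans k.le_succ)]

theorem measurable_walk (m w : ℕ) (u : ℤ) (k : ℕ) : Measurable fun s => walk m w u s k := by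
  have h : ∀ i, Measurable fun s : (ℕ → ℕ) × (ℕ → ℕ) => (s.1 i : ℤ) := fun i =>
    Measurable.of_discrete.comp ((measurable_pi_apply i).comp measurable_fst)
  have h' : ∀ i, Measurable fun s : (ℕ → ℕ) × (ℕ → ℕ) => (s.2 i : ℤ) := fun i =>
    Measurable.of_discrete.comp ((measurable_pi_apply i).comp measurable_snd)
  unfold walk
  fun_prop

theorem measurable_killed (m w : ℕ) (u : ℤ) (f : ℤ → ℂ) (k : ℕ) :
    Measurable fun s => killed m w u f s k := by
  refine Measurable.ite ?_ (Measurable.of_discrete.comp (measurable_walk m w u k))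
    measurable_const
  simp only [Set.ofPred_forall]
  exact MeasurableSet.iInter fun j => MeasurableSet.iInter fun _ =>
    measurable_walk m w u j (MeasurableSet.of_discrete (s := Set.Ici 0))

theorem norm_killed_le (m w : ℕ) {u : ℤ} (hu : 0 ≤ u) {C : ℝ} (hC : 0 ≤ C) {f : ℤ → ℂ}
    (hf : ∀ v, 0 ≤ v → ‖f v‖ ≤ C * (1 + v)) (s : (ℕ → ℕ) × (ℕ → ℕ)) (k : ℕ) :
    ‖killed m w u f s k‖ ≤ C * (1 + u + m * ∑ i ∈ Finset.range k, (s.1 i : ℝ)) := by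
  have hu' : (0 : ℝ) ≤ u := by exact_mod_cast hu
  simp only [killed]
  split_ifs with h
  · refine (hf _ (h k le_rfl)).trans (mul_le_mul_of_nonneg_left ?_ hC)
    simp only [walk]
    push_cast
    have : (0 : ℝ) ≤ w * ∑ i ∈ Finset.range k, (s.2 i : ℝ) := by positivity
    linarith
  · rw [norm_zero]
    positivity

/-- The pairs `(X k, Y k)` have law `Poisson α ⊗ Poisson β`, and each one is independent of the
preceding ones. -/
structure IsPoissonSteps {Ω : Type*} [MeasurableSpace Ω] (X Y : ℕ → Ω → ℕ) (α β : ℝ≥0)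
    (P : Measure Ω) : Prop where
  measurable_fst : ∀ k, Measurable (X k)
  measurable_snd : ∀ k, Measurable (Y k)
  law : ∀ k, P.map (fun ω => (X k ω, Y k ω)) = (poissonMeasure α).prod (poissonMeasure β)
  indep : ∀ k, IndepFun (fun ω => ((fun i : Finset.range k => X i ω),
    (fun i : Finset.range k => Y i ω))) (fun ω => (X k ω, Y k ω)) P

/-! ### Moments and Markov property of the killed walk -/

section steps

variable {Ω : Type*} [MeasurableSpace Ω] {P : Measure Ω}
  {X Y : ℕ → Ω → ℕ} {α β : ℝ≥0}

theorem IsPoissonSteps.measurable_seq (h : IsPoissonSteps X Y α β P) :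
    Measurable fun ω => ((fun i => X i ω), (fun i => Y i ω)) :=
  (measurable_pi_lambda _ h.measurable_fst).prodMk (measurable_pi_lambda _ h.measurable_snd)

theorem IsPoissonSteps.integrable_fst (h : IsPoissonSteps X Y α β P) (k : ℕ) :
    Integrable (fun ω => (X k ω : ℝ)) P := by
  have hm := (h.measurable_fst k).prodMk (h.measurable_snd k)
  have h1 : Integrable (fun p : ℕ × ℕ => (p.1 : ℝ)) (P.map fun ω => (X k ω, Y k ω)) := by
    rw [h.law k]
    exact (integrable_natCast_poissonMeasure α).comp_fst _
  exact h1.comp_measurable hm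

theorem IsPoissonSteps.integral_fst (h : IsPoissonSteps X Y α β P) (k : ℕ) :
    ∫ ω, (X k ω : ℝ) ∂P = α := by
  have hm := (h.measurable_fst k).prodMk (h.measurable_snd k)
  have h1 := integral_map (μ := P) hm.aemeasurable
    (Measurable.of_discrete (f := fun p : ℕ × ℕ => (p.1 : ℝ))).aestronglyMeasurable
  rw [← h1, h.law k, integral_fun_fst (fun n : ℕ => (n : ℝ)), integral_natCast_poissonMeasure]
  simp

variable [IsProbabilityMeasure P]

theorem IsPoissonSteps.integrable_killed (h : IsPoissonSteps X Y α β P) (m w : ℕ) {u : ℤ}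
    (hu : 0 ≤ u) {C : ℝ} (hC : 0 ≤ C) {f : ℤ → ℂ} (hf : ∀ v, 0 ≤ v → ‖f v‖ ≤ C * (1 + v))
    (k : ℕ) :
    Integrable (fun ω => killed m w u f ((fun i => X i ω), (fun i => Y i ω)) k) P := by
  refine Integrable.mono' (g := fun ω => C * (1 + u + m * ∑ i ∈ Finset.range k, (X i ω : ℝ))) ?_
    ((measurable_killed m w u f k).comp h.measurable_seq).aestronglyMeasurable
    (ae_of_all _ fun ω => norm_killed_le m w hu hC hf _ k)
  exact ((integrable_const _).add
    ((integrable_finsetSum _ fun i _ => h.integrable_fst i).const_mul _)).const_mul _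

theorem IsPoissonSteps.integral_norm_killed_le (h : IsPoissonSteps X Y α β P) (m w : ℕ) {u : ℤ}
    (hu : 0 ≤ u) {C : ℝ} (hC : 0 ≤ C) {f : ℤ → ℂ} (hf : ∀ v, 0 ≤ v → ‖f v‖ ≤ C * (1 + v))
    (k : ℕ) :
    ∫ ω, ‖killed m w u f ((fun i => X i ω), (fun i => Y i ω)) k‖ ∂P
      ≤ C * (1 + u + m * (k * α)) := by
  have hs : Integrable (fun ω => ∑ i ∈ Finset.range k, (X i ω : ℝ)) P :=
    integrable_finsetSum _ fun i _ => h.integrable_fst i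
  calc _ ≤ ∫ ω, C * (1 + u + m * ∑ i ∈ Finset.range k, (X i ω : ℝ)) ∂P :=
        integral_mono (h.integrable_killed m w hu hC hf k).norm
          (((integrable_const _).add (hs.const_mul _)).const_mul _)
          fun ω => norm_killed_le m w hu hC hf _ k
    _ = _ := by
      rw [integral_const_mul, integral_add (integrable_const _) (hs.const_mul _),
        integral_const_mul, integral_finsetSum _ fun i _ => h.integrable_fst i]
      simp [h.integral_fst]

/-- The one-step mean need not vanish at negative points, so it only inherits the growth bound on `v
≥ 0`; the killed walk needs no more. -/
theorem norm_stepMean_le {C : ℝ} {f : ℤ → ℂ} (hf : LinearGrowth C f) (m w : ℕ)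
    (α β : ℝ≥0) {v : ℤ} (hv : 0 ≤ v) :
    ‖stepMean m w α β f v‖ ≤ C * (1 + m * α) * (1 + v) := by
  have hi : Integrable (fun p : ℕ × ℕ => (p.1 : ℝ))
      ((poissonMeasure α).prod (poissonMeasure β)) :=
    (integrable_natCast_poissonMeasure α).comp_fst _
  refine (norm_integral_le_of_norm_le (g := fun p : ℕ × ℕ => C * (1 + v) * (1 + m * (p.1 : ℝ)))
    (((integrable_const 1).add (hi.const_mul _)).const_mul _)
    (ae_of_all _ fun p => hf.norm_add_sub_le m w hv p.1 p.2)).trans_eq ?_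
  rw [integral_const_mul, integral_add (integrable_const 1) (hi.const_mul _),
    integral_const_mul, integral_fun_fst (fun n : ℕ => (n : ℝ)), integral_natCast_poissonMeasure]
  simp
  ring

/-- The sequence that extends `g` by zero. -/
def extendByZero {k : ℕ} (g : Finset.range k → ℕ) (i : ℕ) : ℕ :=
  if h : i ∈ Finset.range k then g ⟨i, h⟩ else 0

theorem extendByZero_restrict {k : ℕ} (a : ℕ → ℕ) {i : ℕ} (hi : i < k) :
    extendByZero (fun j : Finset.range k => a j) i = a i := by
  simp [extendByZero, hi]

/-- The Markov property of the killed walk. -/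
theorem IsPoissonSteps.integral_killed_succ (h : IsPoissonSteps X Y α β P) (m w : ℕ) {u : ℤ}
    (hu : 0 ≤ u) {C : ℝ} {f : ℤ → ℂ} (hf : LinearGrowth C f) (k : ℕ) :
    ∫ ω, killed m w u f ((fun i => X i ω), (fun i => Y i ω)) (k + 1) ∂P
      = ∫ ω, killed m w u (stepMean m w α β f) ((fun i => X i ω), (fun i => Y i ω)) k ∂P := by
  set past : Ω → (Finset.range k → ℕ) × (Finset.range k → ℕ) := fun ω =>
    ((fun i : Finset.range k => X i ω), (fun i : Finset.range k => Y i ω)) with hpast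
  set new : Ω → ℕ × ℕ := fun ω => (X k ω, Y k ω) with hnew
  have mpast : Measurable past :=
    (measurable_pi_lambda _ fun i : Finset.range k => h.measurable_fst i).prodMk
      (measurable_pi_lambda _ fun i : Finset.range k => h.measurable_snd i)
  have mnew : Measurable new := (h.measurable_fst k).prodMk (h.measurable_snd k)
  have hmap : P.map (fun ω => (past ω, new ω))
      = (P.map past).prod ((poissonMeasure α).prod (poissonMeasure β)) := by
    rw [← h.law k]
    exact (indepFun_iff_map_prod_eq_prod_map_map mpast.aemeasurable mnew.aemeasurable).mp
      (h.indep k)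
  -- Padding the finite past by zeros makes the integrand a function on a countable discrete space,
  -- so its measurability is automatic.
  let ext : (Finset.range k → ℕ) × (Finset.range k → ℕ) → (ℕ → ℕ) × (ℕ → ℕ) := fun g =>
    (extendByZero g.1, extendByZero g.2)
  have hext : ∀ (g : ℤ → ℂ) (ω : Ω), killed m w u g ((fun i => X i ω), (fun i => Y i ω)) k
      = killed m w u g (ext (past ω)) k := fun g ω =>
    killed_congr m w u g fun i hi =>
      ⟨(extendByZero_restrict (fun i => X i ω) hi).symm,
        (extendByZero_restrict (fun i => Y i ω) hi).symm⟩
  let F : ((Finset.range k → ℕ) × (Finset.range k → ℕ)) × (ℕ × ℕ) → ℂ := fun x =>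
    killed m w u (fun v => f (v + m * x.2.1 - w * x.2.2)) (ext x.1) k
  have hF : ∀ ω, killed m w u f ((fun i => X i ω), (fun i => Y i ω)) (k + 1)
      = F (past ω, new ω) := fun ω => by
    rw [killed_succ m w u hf.of_neg, hext]
  have mF : Measurable F := Measurable.of_discrete
  have hi : Integrable F ((P.map past).prod ((poissonMeasure α).prod (poissonMeasure β))) := by
    rw [← hmap, integrable_map_measure mF.aestronglyMeasurable (mpast.prodMk mnew).aemeasurable]
    exact (h.integrable_killed m w hu hf.nonneg hf.norm_le (k + 1)).congr (ae_of_all _ hF)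
  have : IsProbabilityMeasure (P.map past) := Measure.isProbabilityMeasure_map mpast.aemeasurable
  rw [integral_congr_ae (ae_of_all _ hF),
    ← integral_map (mpast.prodMk mnew).aemeasurable mF.aestronglyMeasurable, hmap,
    integral_prod _ hi, integral_congr_ae (ae_of_all _ (hext (stepMean m w α β f))),
    ← integral_map (f := fun x => killed m w u (stepMean m w α β f) (ext x) k)
      mpast.aemeasurable Measurable.of_discrete.aestronglyMeasurable]
  refine integral_congr_ae (ae_of_all _ fun x => ?_)
  simp only [F, killed]
  split_ifs with hx
  · rfl
  · simp

/-- The discounted sum of the means of the killed position, compared to an approximate solution of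
the discounted one-step equation. -/
theorem IsPoissonSteps.exists_hasSum_killed (h : IsPoissonSteps X Y α β P) (m w : ℕ) {u : ℤ}
    (hu : 0 ≤ u) {C ρ ε : ℝ} (hρ0 : 0 ≤ ρ) (hρ1 : ρ < 1) (hε : 0 ≤ ε) {f : ℤ → ℂ}
    (hf : LinearGrowth C f)
    (hfε : ∀ v : ℤ, 0 ≤ v →
      ‖f v - ρ * stepMean m w α β f v - ((1 - ρ : ℝ) : ℂ) * v‖ ≤ ε * (1 + v)) :
    ∃ V : ℂ, HasSum (fun k : ℕ => ((1 - ρ : ℝ) : ℂ) * ρ ^ k *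
        ∫ ω, killed m w u (fun v => v) ((fun i => X i ω), (fun i => Y i ω)) (k + 1) ∂P) V ∧
      ‖ρ * V - f u‖ ≤ (1 - ρ) * u + ε * ((1 + u) / (1 - ρ) + m * α / (1 - ρ) ^ 2) := by
  have hC := hf.nonneg
  have hu' : (0 : ℝ) ≤ u := by exact_mod_cast hu
  have h1ρ : 0 < 1 - ρ := by linarith
  set err : ℤ → ℂ := fun v => f v - ρ * stepMean m w α β f v - ((1 - ρ : ℝ) : ℂ) * v with herr
  set E : (ℤ → ℂ) → ℕ → ℂ := fun g k =>
    ∫ ω, killed m w u g ((fun i => X i ω), (fun i => Y i ω)) k ∂P with hE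
  have hid : ∀ v : ℤ, 0 ≤ v → ‖(v : ℂ)‖ ≤ 1 * (1 + v) := fun v hv => by
    have : (0 : ℝ) ≤ v := by exact_mod_cast hv
    rw [Complex.norm_intCast, abs_of_nonneg this]
    linarith
  have hst : ∀ v : ℤ, 0 ≤ v → ‖stepMean m w α β f v‖ ≤ C * (1 + m * α) * (1 + v) := fun v hv =>
    norm_stepMean_le hf m w α β hv
  have hEb : ∀ {g : ℤ → ℂ} {c : ℝ}, 0 ≤ c → (∀ v, 0 ≤ v → ‖g v‖ ≤ c * (1 + v)) →
      ∀ k, ‖E g k‖ ≤ c * (1 + u + m * (k * α)) := fun hc hg k =>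
    (norm_integral_le_integral_norm _).trans (h.integral_norm_killed_le m w hu hc hg k)
  have hrec : ∀ k, E err k
      = E f k - ρ * E f (k + 1) - ((1 - ρ : ℝ) : ℂ) * E (fun v => v) k := fun k => by
    have i1 := h.integrable_killed m w hu hC hf.norm_le k
    have i2 := h.integrable_killed m w hu (by positivity) hst k
    have i3 := h.integrable_killed m w hu zero_le_one hid k
    have e : E f (k + 1) = E (stepMean m w α β f) k := h.integral_killed_succ m w hu hf k
    rw [e]
    simp only [hE]
    have i12 : Integrable (fun ω => killed m w u f ((fun i => X i ω), (fun i => Y i ω)) k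
        - ρ * killed m w u (stepMean m w α β f) ((fun i => X i ω), (fun i => Y i ω)) k) P :=
      i1.sub (i2.const_mul _)
    rw [← integral_const_mul, ← integral_const_mul, ← integral_sub i1 (i2.const_mul _),
      ← integral_sub i12 (i3.const_mul _)]
    refine integral_congr_ae (ae_of_all _ fun ω => ?_)
    simp only [killed, herr]
    split_ifs <;> simp
  have hgeo : HasSum (fun k : ℕ => ρ ^ k) (1 - ρ)⁻¹ := hasSum_geometric_of_lt_one hρ0 hρ1
  have hgeo' : HasSum (fun k : ℕ => k * ρ ^ k) (ρ / (1 - ρ) ^ 2) :=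
    hasSum_coe_mul_geometric_of_norm_lt_one (by rwa [Real.norm_of_nonneg hρ0])
  have hdom : ∀ c : ℝ, HasSum (fun k : ℕ => ρ ^ k * (c * (1 + u + m * (k * α))))
      (c * ((1 + u) * (1 - ρ)⁻¹ + m * α * (ρ / (1 - ρ) ^ 2))) := fun c => by
    convert! ((hgeo.mul_left (1 + u : ℝ)).add (hgeo'.mul_left (m * α : ℝ))).mul_left c using 2 with k
    ring
  have hterm : ∀ {g : ℤ → ℂ} {c : ℝ}, 0 ≤ c → (∀ v, 0 ≤ v → ‖g v‖ ≤ c * (1 + v)) →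
      ∀ k, ‖(ρ : ℂ) ^ k * E g k‖ ≤ ρ ^ k * (c * (1 + u + m * (k * α))) := fun hc hg k => by
    rw [norm_mul, norm_pow, Complex.norm_real, Real.norm_of_nonneg hρ0]
    exact mul_le_mul_of_nonneg_left (hEb hc hg k) (by positivity)
  have sf : Summable fun k => (ρ : ℂ) ^ k * E f k :=
    Summable.of_norm_bounded (hdom C).summable (hterm hC hf.norm_le)
  have si : Summable fun k => (ρ : ℂ) ^ k * E (fun v => v) k :=
    Summable.of_norm_bounded (hdom 1).summable (hterm zero_le_one hid)
  have be : ‖∑' k, (ρ : ℂ) ^ k * E err k‖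
      ≤ ε * ((1 + u) * (1 - ρ)⁻¹ + m * α * (ρ / (1 - ρ) ^ 2)) :=
    tsum_of_norm_bounded (hdom ε) (hterm hε hfε)
  have hE0 : ∀ g : ℤ → ℂ, E g 0 = g u := fun g => by
    simp [hE, killed, walk_zero, hu]
  have t1 : ∀ {g : ℤ → ℂ}, Summable (fun k => (ρ : ℂ) ^ k * E g k) →
      ∑' k, (ρ : ℂ) ^ k * E g k = g u + ∑' k, (ρ : ℂ) ^ (k + 1) * E g (k + 1) := fun hs => by
    rw [hs.tsum_eq_zero_add, pow_zero, one_mul, hE0]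
  have sf' : Summable fun k => (ρ : ℂ) ^ (k + 1) * E f (k + 1) :=
    (summable_nat_add_iff (f := fun k => (ρ : ℂ) ^ k * E f k) 1).mpr sf
  -- The two sums of means of `f` differ only by the term `k = 0`, which is `f u`.
  have hsum : ∑' k, (ρ : ℂ) ^ k * E err k = ∑' k, (ρ : ℂ) ^ k * E f k
      - ∑' k, (ρ : ℂ) ^ (k + 1) * E f (k + 1)
      - ((1 - ρ : ℝ) : ℂ) * ∑' k, (ρ : ℂ) ^ k * E (fun v => v) k := by
    rw [← tsum_mul_left, ← sf.tsum_sub sf', ← (sf.sub sf').tsum_sub (si.mul_left _)]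
    refine tsum_congr fun k => ?_
    rw [hrec k]
    ring
  rw [t1 sf, t1 si] at hsum
  have sV : Summable fun k => ((1 - ρ : ℝ) : ℂ) * ρ ^ k * E (fun v => v) (k + 1) := by
    refine Summable.of_norm_bounded (g := fun k : ℕ => ρ ^ k * (1 * (1 + u + m * α))
      + ρ ^ k * (1 * (1 + u + m * (k * α)))) ?_ fun k => ?_
    · exact (hgeo.summable.mul_right _).add (hdom 1).summable
    · rw [norm_mul, norm_mul, norm_pow, Complex.norm_real, Complex.norm_real,
        Real.norm_of_nonneg hρ0, Real.norm_of_nonneg h1ρ.le, ← mul_add]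
      have h1 := hEb zero_le_one hid (k + 1)
      have h2 : (1 - ρ) * ρ ^ k ≤ ρ ^ k := mul_le_of_le_one_left (by positivity) (by linarith)
      refine mul_le_mul h2 (h1.trans ?_) (norm_nonneg _) (by positivity)
      push_cast
      linarith
  refine ⟨_, sV.hasSum, ?_⟩
  -- The walk is read at index `k + 1` with weight `ρ ^ k`, so `ρ V` is the full discounted sum
  -- without its term `k = 0`; this omission is the `(1 - ρ) u` in the bound.
  have hV : ρ * ∑' k, ((1 - ρ : ℝ) : ℂ) * ρ ^ k * E (fun v => v) (k + 1)
      = ((1 - ρ : ℝ) : ℂ) * ∑' k, (ρ : ℂ) ^ (k + 1) * E (fun v => v) (k + 1) := by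
    rw [← tsum_mul_left, ← tsum_mul_left]
    refine tsum_congr fun k => ?_
    ring
  rw [hV]
  have hfin : ((1 - ρ : ℝ) : ℂ) * ∑' k, (ρ : ℂ) ^ (k + 1) * E (fun v => v) (k + 1) - f u
      = -(((1 - ρ : ℝ) : ℂ) * u) - ∑' k, (ρ : ℂ) ^ k * E err k := by
    rw [hsum]
    ring
  rw [hfin]
  refine (norm_sub_le _ _).trans (add_le_add ?_ (be.trans ?_))
  · rw [norm_neg, norm_mul, Complex.norm_real, Complex.norm_intCast, abs_of_nonneg hu',
      Real.norm_of_nonneg h1ρ.le]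
  · refine mul_le_mul_of_nonneg_left ?_ hε
    rw [← div_eq_mul_inv, ← mul_div_assoc]
    exact add_le_add le_rfl (div_le_div_of_nonneg_right
      (mul_le_of_le_one_right (by positivity) hρ1.le) (by positivity))

end steps

/-! ### The increments of independent Poisson processes -/

/-- Regroups independence between two processes and independence of past and new increment within
each into independence of the joint past from the joint new increment. On countable spaces it
suffices to compare singletons. -/
theorem indepFun_prodMk_of_countable {Ω A B C D : Type*} [MeasurableSpace Ω] {P : Measure Ω}
    [IsProbabilityMeasure P]
    [MeasurableSpace A] [Countable A] [MeasurableSingletonClass A]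
    [MeasurableSpace B] [Countable B] [MeasurableSingletonClass B]
    [MeasurableSpace C] [Countable C] [MeasurableSingletonClass C]
    [MeasurableSpace D] [Countable D] [MeasurableSingletonClass D]
    {f : Ω → A} {g : Ω → B} {f' : Ω → C} {g' : Ω → D}
    (hf : Measurable f) (hg : Measurable g) (hf' : Measurable f') (hg' : Measurable g')
    (h : IndepFun (fun ω => (f ω, g ω)) (fun ω => (f' ω, g' ω)) P)
    (h1 : IndepFun f g P) (h2 : IndepFun f' g' P) :
    IndepFun (fun ω => (f ω, f' ω)) (fun ω => (g ω, g' ω)) P := by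
  have h3 : IndepFun f f' P := h.comp measurable_fst measurable_fst
  have h4 : IndepFun g g' P := h.comp measurable_snd measurable_snd
  have e1 := (indepFun_iff_map_prod_eq_prod_map_map hf.aemeasurable hg.aemeasurable).mp h1
  have e2 := (indepFun_iff_map_prod_eq_prod_map_map hf'.aemeasurable hg'.aemeasurable).mp h2
  have e3 := (indepFun_iff_map_prod_eq_prod_map_map hf.aemeasurable hf'.aemeasurable).mp h3
  have e4 := (indepFun_iff_map_prod_eq_prod_map_map hg.aemeasurable hg'.aemeasurable).mp h4
  have e := (indepFun_iff_map_prod_eq_prod_map_map (hf.prodMk hg).aemeasurable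
    (hf'.prodMk hg').aemeasurable).mp h
  rw [indepFun_iff_map_prod_eq_prod_map_map (hf.prodMk hf').aemeasurable
    (hg.prodMk hg').aemeasurable, e3, e4]
  rw [e1, e2] at e
  have := Measure.isProbabilityMeasure_map (μ := P) hf.aemeasurable
  have := Measure.isProbabilityMeasure_map (μ := P) hg.aemeasurable
  have := Measure.isProbabilityMeasure_map (μ := P) hf'.aemeasurable
  have := Measure.isProbabilityMeasure_map (μ := P) hg'.aemeasurable
  refine Measure.ext_of_singleton fun x => ?_
  obtain ⟨⟨a, c⟩, ⟨b, d⟩⟩ := x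
  have e5 : P.map (fun ω => ((f ω, f' ω), (g ω, g' ω))) {((a, c), (b, d))}
      = P.map (fun ω => ((f ω, g ω), (f' ω, g' ω))) {((a, b), (c, d))} := by
    rw [Measure.map_apply ((hf.prodMk hf').prodMk (hg.prodMk hg')) (measurableSet_singleton _),
      Measure.map_apply ((hf.prodMk hg).prodMk (hf'.prodMk hg')) (measurableSet_singleton _)]
    congr 1
    ext ω
    simp only [Set.mem_preimage, Set.mem_singleton_iff, Prod.mk.injEq]
    tauto
  rw [e5, e]
  simp only [← Set.singleton_prod_singleton, Measure.prod_prod]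
  ring

/-- The increments of a process along the grid of step size `h`. -/
def gridIncrement (h : ℝ≥0) (p : ℝ≥0 → ℕ) (i : ℕ) : ℕ :=
  p ((i + 1 : ℕ) * h) - p (i * h)

theorem measurable_gridIncrement (h : ℝ≥0) : Measurable (gridIncrement h) := by
  refine measurable_pi_lambda _ fun i => ?_
  exact (measurable_pi_apply _).sub (measurable_pi_apply _)

theorem sum_gridIncrement (h : ℝ≥0) {p : ℝ≥0 → ℕ} (hp : Monotone p) (h0 : p 0 = 0) (k : ℕ) :
    ∑ i ∈ Finset.range k, gridIncrement h p i = p (k * h) := by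
  have hm : Monotone fun i : ℕ => p (i * h) := fun i j hij => hp (by gcongr)
  have := Finset.sum_range_tsub hm k
  simpa [gridIncrement, h0] using this

section processes

variable {Ω : Type*} [MeasurableSpace Ω] {P : Measure Ω}

theorem IsPoissonProcess.measurable_gridIncrement_apply {N : ℝ≥0 → Ω → ℕ} {lam : ℝ}
    (hN : IsPoissonProcess N lam P) (h : ℝ≥0) (i : ℕ) :
    Measurable fun ω => gridIncrement h (fun s => N s ω) i :=
  (hN.measurable _).sub (hN.measurable _)

theorem IsPoissonProcess.map_gridIncrement {N : ℝ≥0 → Ω → ℕ} {lam : ℝ}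
    (hN : IsPoissonProcess N lam P) (h : ℝ≥0) (i : ℕ) :
    P.map (fun ω => gridIncrement h (fun s => N s ω) i) = poissonMeasure (lam * h).toNNReal := by
  have h1 : ((i : ℕ) * h : ℝ≥0) ≤ (i + 1 : ℕ) * h := by gcongr; omega
  have h2 := (hN.law _ _ h1).map_eq
  have e : lam * ((((i + 1 : ℕ) * h : ℝ≥0) : ℝ) - ((i * h : ℝ≥0) : ℝ)) = lam * h := by
    push_cast
    ring
  rw [e] at h2
  exact h2

theorem IsPoissonProcess.indepFun_gridIncrement {N : ℝ≥0 → Ω → ℕ} {lam : ℝ}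
    (hN : IsPoissonProcess N lam P) (h : ℝ≥0) (k : ℕ) :
    IndepFun (fun ω => fun i : Finset.range k => gridIncrement h (fun s => N s ω) i)
      (fun ω => gridIncrement h (fun s => N s ω) k) P := by
  have hm : Monotone fun i : ℕ => (i * h : ℝ≥0) := fun i j hij => by
    simp only
    gcongr
  have h1 := hN.indep.nat hm
  have hd : Disjoint (Finset.range k) {k} := by simp
  have h2 := h1.indepFun_finset (Finset.range k) {k} hd
    fun i => (hN.measurable _).sub (hN.measurable _)
  exact h2.comp measurable_id
    (measurable_pi_apply (⟨k, Finset.mem_singleton_self k⟩ : ({k} : Finset ℕ)))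

theorem isPoissonSteps_gridIncrement [IsProbabilityMeasure P] {N Md : ℝ≥0 → Ω → ℕ} {lam mud : ℝ}
    (hN : IsPoissonProcess N lam P) (hMd : IsPoissonProcess Md mud P)
    (hNMd : IndepFun (fun ω s => N s ω) (fun ω s => Md s ω) P) (h : ℝ≥0) :
    IsPoissonSteps (fun i ω => gridIncrement h (fun s => N s ω) i)
      (fun i ω => gridIncrement h (fun s => Md s ω) i)
      (lam * h).toNNReal (mud * h).toNNReal P where
  measurable_fst k := hN.measurable_gridIncrement_apply h k
  measurable_snd k := hMd.measurable_gridIncrement_apply h k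
  law k := by
    have hi : IndepFun (fun ω => gridIncrement h (fun s => N s ω) k)
        (fun ω => gridIncrement h (fun s => Md s ω) k) P :=
      hNMd.comp ((measurable_pi_apply k).comp (measurable_gridIncrement h))
        ((measurable_pi_apply k).comp (measurable_gridIncrement h))
    rw [(indepFun_iff_map_prod_eq_prod_map_map
      (hN.measurable_gridIncrement_apply h k).aemeasurable
      (hMd.measurable_gridIncrement_apply h k).aemeasurable).mp hi, hN.map_gridIncrement,
      hMd.map_gridIncrement]
  indep k := by
    have hφ : Measurable fun p : ℝ≥0 → ℕ =>
        ((fun i : Finset.range k => gridIncrement h p i), gridIncrement h p k) :=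
      (measurable_pi_lambda _ fun i : Finset.range k =>
        (measurable_pi_apply _).comp (measurable_gridIncrement h)).prodMk
        ((measurable_pi_apply _).comp (measurable_gridIncrement h))
    exact indepFun_prodMk_of_countable
      (measurable_pi_lambda _ fun i : Finset.range k => hN.measurable_gridIncrement_apply h i)
      (hN.measurable_gridIncrement_apply h k)
      (measurable_pi_lambda _ fun i : Finset.range k => hMd.measurable_gridIncrement_apply h i)
      (hMd.measurable_gridIncrement_apply h k)
      (hNMd.comp hφ hφ) (hN.indepFun_gridIncrement h k) (hMd.indepFun_gridIncrement h k)

end processes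

/-! ### Exponential times on a grid -/

theorem expMeasure_real_Ico {r : ℝ} (hr : 0 < r) {x y : ℝ} (hx : 0 ≤ x) (hxy : x ≤ y) :
    (expMeasure r).real (Set.Ico x y) = Real.exp (-(r * x)) - Real.exp (-(r * y)) := by
  have := isProbabilityMeasure_expMeasure hr
  have hac : expMeasure r ≪ volume := withDensity_absolutelyContinuous _ _
  have hIio : ∀ z, 0 ≤ z → (expMeasure r).real (Set.Iio z) = 1 - Real.exp (-(r * z)) := by
    intro z hz
    have h1 : (expMeasure r).real (Set.Iic z) = 1 - Real.exp (-(r * z)) := by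
      rw [← cdf_eq_real, cdf_expMeasure_eq hr, if_pos hz]
    have h2 : expMeasure r {z} = 0 := hac (by simp)
    have h3 : Set.Iio z =ᵐ[expMeasure r] Set.Iic z := by
      rw [← Set.Iic_sdiff_right]
      exact sdiff_null_ae_eq_self h2
    rw [measureReal_congr h3, h1]
  have e : Set.Ico x y = Set.Iio y \ Set.Iio x := by
    ext z
    simp
  rw [e, measureReal_sdiff (Set.Iio_subset_Iio hxy) measurableSet_Iio,
    hIio y (hx.trans hxy), hIio x hx]
  ring

section geometric

variable {Ω : Type*} [MeasurableSpace Ω] {P : Measure Ω}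

/-- The number of complete grid intervals before an exponential time is geometric. -/
theorem measureReal_floor_mul_eq {T : Ω → ℝ≥0} {t : ℝ} (ht : 0 < t)
    (hT : HasLaw (fun ω => (T ω : ℝ)) (expMeasure (1 / t)) P) {n : ℕ} (hn : 0 < n) (k : ℕ) :
    P.real ((fun ω => ⌊T ω * n⌋₊) ⁻¹' {k})
      = (1 - Real.exp (-((n : ℝ≥0)⁻¹ / t))) * Real.exp (-((n : ℝ≥0)⁻¹ / t)) ^ k := by
  have hn' : (0 : ℝ) < n := by exact_mod_cast hn
  have e : (fun ω => ⌊T ω * n⌋₊) ⁻¹' {k}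
      = (fun ω => (T ω : ℝ)) ⁻¹' Set.Ico ((k : ℝ) / n) ((k + 1 : ℝ) / n) := by
    ext ω
    simp only [Set.mem_preimage, Set.mem_singleton_iff, Set.mem_Ico]
    rw [Nat.floor_eq_iff (by positivity), div_le_iff₀ hn', lt_div_iff₀ hn']
    constructor <;> rintro ⟨h1, h2⟩ <;> exact ⟨by exact_mod_cast h1, by exact_mod_cast h2⟩
  rw [e, measureReal_def, ← Measure.map_apply_of_aemeasurable hT.aemeasurable measurableSet_Ico,
    hT.map_eq, ← measureReal_def, expMeasure_real_Ico (by positivity) (by positivity)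
      (by gcongr; linarith), ← Real.exp_nat_mul, sub_mul, one_mul, ← Real.exp_add]
  push_cast
  congr 2 <;> field_simp
  ring

/-- Applied with `φ` the norm, for integrability, and with `φ` the identity, for the value. -/
theorem setIntegral_preimage_of_indepFun {E : Type*} [NormedAddCommGroup E] [NormedSpace ℝ E]
    {K : Ω → ℕ} (hK : Measurable K) {Z : Ω → ℂ}
    (hZ : Integrable Z P) (hind : IndepFun K Z P) {φ : ℂ → E} (hφ : Continuous φ) (k : ℕ) :
    ∫ ω in K ⁻¹' {k}, φ (Z ω) ∂P = P.real (K ⁻¹' {k}) • ∫ ω, φ (Z ω) ∂P := by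
  have h := hind.integral_fun_comp_smul_comp (𝕜 := ℝ) (f := Set.indicator {k} 1) (g := φ)
    hK.aemeasurable hZ.1.aemeasurable Measurable.of_discrete.aestronglyMeasurable
    hφ.aestronglyMeasurable
  have hm : MeasurableSet (K ⁻¹' {k}) := hK (measurableSet_singleton k)
  have e : (fun ω => (Set.indicator {k} 1 (K ω) : ℝ)) = Set.indicator (K ⁻¹' {k}) 1 := rfl
  rw [e, integral_indicator_one hm] at h
  rw [← h, ← integral_indicator hm]
  refine integral_congr_ae (ae_of_all _ fun ω => ?_)
  by_cases hω : K ω = k <;> simp [hω]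

/-- Evaluation of a sequence of random variables at an independent random index. -/
theorem integral_comp_random_index {K : Ω → ℕ} (hK : Measurable K)
    {Y : ℕ → Ω → ℂ} (hY : ∀ k, Integrable (Y k) P) (hind : ∀ k, IndepFun K (Y k) P)
    (hs : Summable fun k => P.real (K ⁻¹' {k}) * ∫ ω, ‖Y k ω‖ ∂P) :
    Integrable (fun ω => Y (K ω) ω) P ∧
      HasSum (fun k => (P.real (K ⁻¹' {k}) : ℂ) * ∫ ω, Y k ω ∂P) (∫ ω, Y (K ω) ω ∂P) := by
  have hm : ∀ k, MeasurableSet (K ⁻¹' {k}) := fun k => hK (measurableSet_singleton k)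
  have hU : ⋃ k, K ⁻¹' {k} = Set.univ := by
    ext ω
    simp
  have hd : Pairwise (Function.onFun Disjoint fun k => K ⁻¹' {k}) := fun i j hij =>
    Disjoint.preimage K (Set.disjoint_singleton.mpr hij)
  have heq : ∀ k, Set.EqOn (fun ω => Y (K ω) ω) (Y k) (K ⁻¹' {k}) := fun k ω hω => by
    simp only [Set.mem_preimage, Set.mem_singleton_iff] at hω
    simp only [hω]
  have hi : ∀ k, IntegrableOn (fun ω => Y (K ω) ω) (K ⁻¹' {k}) P := fun k =>
    (hY k).integrableOn.congr_fun (heq k).symm (hm k)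
  have hint : IntegrableOn (fun ω => Y (K ω) ω) (⋃ k, K ⁻¹' {k}) P := by
    refine integrableOn_iUnion_of_summable_integral_norm hi (hs.congr fun k => ?_)
    rw [← smul_eq_mul, ← setIntegral_preimage_of_indepFun hK (hY k) (hind k) continuous_norm k]
    exact setIntegral_congr_fun (hm k) fun ω hω => by rw [← heq k hω]
  have hsum := hasSum_integral_iUnion hm hd hint
  rw [hU, setIntegral_univ] at hsum
  rw [hU, integrableOn_univ] at hint
  refine ⟨hint, ?_⟩
  convert! hsum using 2 with k
  have h := setIntegral_preimage_of_indepFun hK (hY k) (hind k) continuous_id k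
  simp only [id] at h
  rw [← Complex.real_smul, ← h]
  exact setIntegral_congr_fun (hm k) fun ω hω => (heq k hω).symm

end geometric

/-! ### Survival along a grid -/

section survival

open Filter Topology

/-- Nonnegativity up to `T` gives only `τ ≥ T` in general; the path being constant just after `T`
makes the inequality strict. -/
theorem survivingSurplus_eq_ite {Ω : Type*} {R : ℝ≥0 → Ω → ℝ} {T : Ω → ℝ≥0} {ω : Ω}
    (hR : ∀ s, ∀ᶠ s' in 𝓝[≥] s, R s' ω = R s ω) [Decidable (∀ s ≤ T ω, 0 ≤ R s ω)] :
    survivingSurplus R T ω = if ∀ s ≤ T ω, 0 ≤ R s ω then R (T ω) ω else 0 := by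
  have key : (T ω : WithTop ℝ≥0) < ruinTime R ω ↔ ∀ s ≤ T ω, 0 ≤ R s ω := by
    constructor
    · intro h s hs
      by_contra! hneg
      have h1 : ruinTime R ω ≤ (s : WithTop ℝ≥0) :=
        hittingAfter_le_of_mem zero_le hneg
      exact absurd (h.trans_le h1) (not_lt.mpr (WithTop.coe_le_coe.mpr hs))
    · intro h
      obtain ⟨e, he, hsub⟩ := mem_nhdsGE_iff_exists_Ico_subset.mp (hR (T ω))
      have hle : (e : WithTop ℝ≥0) ≤ ruinTime R ω := by
        by_contra! hlt
        obtain ⟨j, ⟨-, hj⟩, hjneg⟩ := hittingAfter_lt_iff.mp hlt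
        rcases le_total j (T ω) with h1 | h1
        · exact absurd (h j h1) (not_le.mpr hjneg)
        · have h2 : R j ω = R (T ω) ω := hsub ⟨h1, hj⟩
          have h3 : R j ω < 0 := hjneg
          linarith [h (T ω) le_rfl]
      exact (WithTop.coe_lt_coe.mpr he).trans_le hle
  rw [survivingSurplus]
  by_cases h : ∀ s ≤ T ω, 0 ≤ R s ω
  · rw [if_pos h, Set.indicator_of_mem (by exact key.mpr h)]
  · rw [if_neg h, Set.indicator_of_notMem (by exact fun h2 => h (key.mp h2))]

-- The grid is read at the first point strictly after `T`. The path is constant just after `T`, so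
-- this point eventually gives the exact value; and a ruin at `s ≤ T` persists for a short time,
-- long enough for a fine grid to see it.
open Classical in
theorem tendsto_grid_survival {r : ℝ≥0 → ℝ} (hr : ∀ s, ∀ᶠ s' in 𝓝[≥] s, r s' = r s) (T : ℝ≥0) :
    Tendsto (fun n : ℕ => if ∀ j ≤ ⌊T * n⌋₊ + 1, 0 ≤ r (j * (n : ℝ≥0)⁻¹)
        then r ((⌊T * n⌋₊ + 1 : ℕ) * (n : ℝ≥0)⁻¹) else 0) atTop
      (𝓝 (if ∀ s ≤ T, 0 ≤ r s then r T else 0)) := by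
  have hinv : Tendsto (fun n : ℕ => (n : ℝ≥0)⁻¹) atTop (𝓝 0) :=
    tendsto_inv_atTop_zero.comp tendsto_natCast_atTop_atTop
  have hlt : ∀ s e : ℝ≥0, s < e → ∀ᶠ n : ℕ in atTop, s + (n : ℝ≥0)⁻¹ < e := fun s e hse => by
    have h1 : Tendsto (fun n : ℕ => s + (n : ℝ≥0)⁻¹) atTop (𝓝 s) := by
      simpa using hinv.const_add s
    exact h1.eventually_lt_const hse
  refine tendsto_const_nhds.congr' ?_
  by_cases h : ∀ s ≤ T, 0 ≤ r s
  · obtain ⟨e, he, hsub⟩ := mem_nhdsGE_iff_exists_Ico_subset.mp (hr T)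
    filter_upwards [hlt T e he, eventually_gt_atTop 0] with n hn hn0
    have hn0' : (0 : ℝ≥0) < n := by exact_mod_cast hn0
    have hfl : (⌊T * n⌋₊ : ℝ≥0) ≤ T * n := Nat.floor_le (by positivity)
    have hfl' : T * n < (⌊T * n⌋₊ + 1 : ℕ) := by exact_mod_cast Nat.lt_floor_add_one (T * n)
    have hend : ((⌊T * n⌋₊ + 1 : ℕ) : ℝ≥0) * (n : ℝ≥0)⁻¹ < e := by
      refine lt_of_le_of_lt ?_ hn
      rw [← div_eq_mul_inv, div_le_iff₀ hn0', add_mul, inv_mul_cancel₀ hn0'.ne']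
      push_cast
      gcongr
    have hT : T ≤ ((⌊T * n⌋₊ + 1 : ℕ) : ℝ≥0) * (n : ℝ≥0)⁻¹ := by
      rw [← div_eq_mul_inv, le_div_iff₀ hn0']
      exact hfl'.le
    have hval : r (((⌊T * n⌋₊ + 1 : ℕ) : ℝ≥0) * (n : ℝ≥0)⁻¹) = r T := hsub ⟨hT, hend⟩
    rw [if_pos h, if_pos, hval]
    intro j hj
    have hj' : (j : ℝ≥0) * (n : ℝ≥0)⁻¹ ≤ ((⌊T * n⌋₊ + 1 : ℕ) : ℝ≥0) * (n : ℝ≥0)⁻¹ := by gcongr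
    rcases le_total ((j : ℝ≥0) * (n : ℝ≥0)⁻¹) T with h1 | h1
    · exact h _ h1
    · have h2 : r ((j : ℝ≥0) * (n : ℝ≥0)⁻¹) = r T := hsub ⟨h1, hj'.trans_lt hend⟩
      rw [h2]
      exact h T le_rfl
  · rw [if_neg h]
    push Not at h
    obtain ⟨s, hsT, hs⟩ := h
    obtain ⟨e, he, hsub⟩ := mem_nhdsGE_iff_exists_Ico_subset.mp (hr s)
    filter_upwards [hlt s e he, eventually_gt_atTop 0] with n hn hn0
    have hn0' : (0 : ℝ≥0) < n := by exact_mod_cast hn0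
    rw [if_neg]
    push Not
    -- The first grid point at or after `s`; the extra `+ 1` in the range of `j` ensures that it is
    -- tested.
    refine ⟨⌈s * n⌉₊, ?_, ?_⟩
    · refine (Nat.ceil_le_floor_add_one _).trans ?_
      gcongr
    · have h1 : s ≤ (⌈s * n⌉₊ : ℝ≥0) * (n : ℝ≥0)⁻¹ := by
        rw [← div_eq_mul_inv, le_div_iff₀ hn0']
        exact Nat.le_ceil _
      have h2 : (⌈s * n⌉₊ : ℝ≥0) * (n : ℝ≥0)⁻¹ < e := by
        refine lt_of_le_of_lt ?_ hn
        rw [← div_eq_mul_inv, div_le_iff₀ hn0', add_mul, inv_mul_cancel₀ hn0'.ne']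
        exact (Nat.ceil_lt_add_one (by positivity)).le
      have h3 : r ((⌈s * n⌉₊ : ℝ≥0) * (n : ℝ≥0)⁻¹) = r s := hsub ⟨h1, h2⟩
      rw [h3]
      exact hs

theorem IsPoissonProcess.eventually_eq {Ω : Type*} [MeasurableSpace Ω] {P : Measure Ω}
    {N : ℝ≥0 → Ω → ℕ} {lam : ℝ} (hN : IsPoissonProcess N lam P) (ω : Ω) (s : ℝ≥0) :
    ∀ᶠ s' in 𝓝[≥] s, N s' ω = N s ω :=
  (hN.rightCont ω s).eventually_mem (IsOpen.mem_nhds (isOpen_discrete {N s ω}) rfl)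

theorem poolSurplus_shareProcess {Ω : Type*} (u b w : ℝ) (N Md : ℝ≥0 → Ω → ℕ) (s : ℝ≥0) (ω : Ω) :
    poolSurplus u b w N (shareProcess N Md) s ω = u - w * Md s ω + (b - w) * N s ω := by
  simp only [poolSurplus, shareProcess]
  push_cast
  ring

section discretization

variable {Ω : Type*} [MeasurableSpace Ω] {P : Measure Ω}

/-- The increments of the two processes along the grid of step size `h`. -/
def gridSteps (h : ℝ≥0) (N Md : ℝ≥0 → Ω → ℕ) (ω : Ω) : (ℕ → ℕ) × (ℕ → ℕ) :=
  (gridIncrement h (fun s => N s ω), gridIncrement h (fun s => Md s ω))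

theorem walk_gridSteps {N Md : ℝ≥0 → Ω → ℕ} {lam mud : ℝ} (hN : IsPoissonProcess N lam P)
    (hMd : IsPoissonProcess Md mud P) {b w : ℕ} (hwb : w < b) (u : ℕ) (h : ℝ≥0) (ω : Ω) (k : ℕ) :
    (walk (b - w) w u (gridSteps h N Md ω) k : ℝ)
      = poolSurplus u b w N (shareProcess N Md) (k * h) ω := by
  have e1 := sum_gridIncrement h (hN.mono ω) (hN.zero ω) k
  have e2 := sum_gridIncrement h (hMd.mono ω) (hMd.zero ω) k
  rw [poolSurplus_shareProcess, walk, ← Nat.cast_sum, ← Nat.cast_sum]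
  simp only [gridSteps]
  rw [e1, e2]
  push_cast [hwb.le]
  ring

open Classical in
theorem killed_gridSteps {N Md : ℝ≥0 → Ω → ℕ} {lam mud : ℝ} (hN : IsPoissonProcess N lam P)
    (hMd : IsPoissonProcess Md mud P) {b w : ℕ} (hwb : w < b) (u : ℕ) (h : ℝ≥0) (ω : Ω) (k : ℕ) :
    killed (b - w) w u (fun v => v) (gridSteps h N Md ω) k
      = ((if ∀ j ≤ k, 0 ≤ poolSurplus u b w N (shareProcess N Md) (j * h) ω
          then poolSurplus u b w N (shareProcess N Md) (k * h) ω else 0 : ℝ) : ℂ) := by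
  simp only [← walk_gridSteps hN hMd hwb, killed, Int.cast_nonneg_iff]
  split_ifs <;> simp

theorem tendsto_killed_gridSteps {N Md : ℝ≥0 → Ω → ℕ} {lam mud : ℝ}
    (hN : IsPoissonProcess N lam P) (hMd : IsPoissonProcess Md mud P) {b w : ℕ} (hwb : w < b)
    (u : ℕ) (T : Ω → ℝ≥0) (ω : Ω) :
    Tendsto (fun n : ℕ => killed (b - w) w u (fun v => v)
        (gridSteps (n : ℝ≥0)⁻¹ N Md ω) (⌊T ω * n⌋₊ + 1)) atTop
      (𝓝 (survivingSurplus (poolSurplus u b w N (shareProcess N Md)) T ω : ℂ)) := by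
  classical
  have hR : ∀ s, ∀ᶠ s' in 𝓝[≥] s, poolSurplus u b w N (shareProcess N Md) s' ω
      = poolSurplus u b w N (shareProcess N Md) s ω := fun s => by
    filter_upwards [hN.eventually_eq ω s, hMd.eventually_eq ω s] with s' h1 h2
    rw [poolSurplus_shareProcess, poolSurplus_shareProcess, h1, h2]
  simp only [killed_gridSteps hN hMd hwb]
  rw [survivingSurplus_eq_ite hR]
  exact (Complex.continuous_ofReal.tendsto _).comp
    (tendsto_grid_survival (r := fun s => poolSurplus u b w N (shareProcess N Md) s ω) hR (T ω))

/-- The first grid point after `T` is at most `⌊T⌋ + 1` for every `n`, which gives a dominating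
function independent of `n`. -/
theorem norm_killed_gridSteps_le {N Md : ℝ≥0 → Ω → ℕ} {lam : ℝ}
    (hN : IsPoissonProcess N lam P) (m w u : ℕ) (T : Ω → ℝ≥0) (ω : Ω) {n : ℕ} (hn : 0 < n) :
    ‖killed m w u (fun v => v) (gridSteps (n : ℝ≥0)⁻¹ N Md ω) (⌊T ω * n⌋₊ + 1)‖
      ≤ 1 + u + m * N (⌊T ω⌋₊ + 1 : ℕ) ω := by
  have hn' : (0 : ℝ≥0) < n := by exact_mod_cast hn
  have hid : ∀ v : ℤ, 0 ≤ v → ‖(v : ℂ)‖ ≤ 1 * (1 + v) := fun v hv => by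
    have : (0 : ℝ) ≤ v := by exact_mod_cast hv
    rw [Complex.norm_intCast, abs_of_nonneg this]
    linarith
  refine (norm_killed_le m w (Int.natCast_nonneg u) zero_le_one hid _ _).trans ?_
  rw [one_mul, ← Nat.cast_sum]
  simp only [gridSteps]
  rw [sum_gridIncrement _ (hN.mono ω) (hN.zero ω)]
  have h1 : ((⌊T ω * n⌋₊ + 1 : ℕ) : ℝ≥0) * (n : ℝ≥0)⁻¹ ≤ (⌊T ω⌋₊ + 1 : ℕ) := by
    rw [← div_eq_mul_inv, div_le_iff₀ hn']
    have h2 : T ω * n < ((⌊T ω⌋₊ + 1) * n : ℕ) := by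
      push_cast
      exact mul_lt_mul_of_pos_right (Nat.lt_floor_add_one _) hn'
    have h3 : ⌊T ω * n⌋₊ < (⌊T ω⌋₊ + 1) * n := (Nat.floor_lt (by positivity)).mpr h2
    exact_mod_cast h3
  have h4 : N (((⌊T ω * n⌋₊ + 1 : ℕ) : ℝ≥0) * (n : ℝ≥0)⁻¹) ω ≤ N (⌊T ω⌋₊ + 1 : ℕ) ω :=
    hN.mono ω h1
  have h5 : (N (((⌊T ω * n⌋₊ + 1 : ℕ) : ℝ≥0) * (n : ℝ≥0)⁻¹) ω : ℝ) ≤ N (⌊T ω⌋₊ + 1 : ℕ) ω := by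
    exact_mod_cast h4
  push_cast
  push_cast at h5
  gcongr

end discretization

end survival

/-! ### The value function -/

section value

open Filter Topology

variable {Ω : Type*} [MeasurableSpace Ω] {P : Measure Ω}
  {lam mud t : ℝ} {N Md : ℝ≥0 → Ω → ℕ} {T : Ω → ℝ≥0}

theorem measurable_gridSteps_paths (h : ℝ≥0) :
    Measurable fun p : (ℝ≥0 → ℕ) × (ℝ≥0 → ℕ) => (gridIncrement h p.1, gridIncrement h p.2) :=
  ((measurable_gridIncrement h).comp measurable_fst).prodMk
    ((measurable_gridIncrement h).comp measurable_snd)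

theorem indepFun_floor_gridSteps
    (hTindep : IndepFun T (fun ω => ((fun s => N s ω), (fun s => Md s ω))) P) (n : ℕ) (h : ℝ≥0)
    {φ : (ℕ → ℕ) × (ℕ → ℕ) → ℂ} (hφ : Measurable φ) :
    IndepFun (fun ω => ⌊T ω * n⌋₊) (fun ω => φ (gridSteps h N Md ω)) P :=
  hTindep.comp (Nat.measurable_floor.comp (measurable_id.mul_const _))
    (hφ.comp (measurable_gridSteps_paths h))

theorem summable_geometric_mul_affine {ρ : ℝ} (hρ0 : 0 ≤ ρ) (hρ1 : ρ < 1) (x y : ℝ) :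
    Summable fun k : ℕ => (1 - ρ) * ρ ^ k * (x + y * (k + 1 : ℕ)) := by
  have h1 := (summable_geometric_of_lt_one hρ0 hρ1).mul_left ((1 - ρ) * (x + y))
  have h2 := (hasSum_coe_mul_geometric_of_norm_lt_one (r := ρ)
    (by rwa [Real.norm_of_nonneg hρ0])).summable.mul_left ((1 - ρ) * y)
  refine (h1.add h2).congr fun k => ?_
  push_cast
  ring

/-- The mean of a sequence of functionals of the grid increments with at most linear growth, at the
first grid point after the exponential time. -/
theorem integral_gridSteps_floor (ht : 0 < t)
    (hT : HasLaw (fun ω => (T ω : ℝ)) (expMeasure (1 / t)) P) (hTm : Measurable T)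
    (hTindep : IndepFun T (fun ω => ((fun s => N s ω), (fun s => Md s ω))) P)
    {n : ℕ} (hn : 0 < n) {φ : ℕ → (ℕ → ℕ) × (ℕ → ℕ) → ℂ} (hφ : ∀ k, Measurable (φ k))
    (hi : ∀ k, Integrable (fun ω => φ k (gridSteps (n : ℝ≥0)⁻¹ N Md ω)) P) {x y : ℝ}
    (hb : ∀ k, ∫ ω, ‖φ k (gridSteps (n : ℝ≥0)⁻¹ N Md ω)‖ ∂P ≤ x + y * k) :
    Integrable (fun ω => φ (⌊T ω * n⌋₊ + 1) (gridSteps (n : ℝ≥0)⁻¹ N Md ω)) P ∧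
      HasSum (fun k : ℕ => ((1 - Real.exp (-((n : ℝ≥0)⁻¹ / t)) : ℝ) : ℂ)
          * (Real.exp (-((n : ℝ≥0)⁻¹ / t)) : ℂ) ^ k
          * ∫ ω, φ (k + 1) (gridSteps (n : ℝ≥0)⁻¹ N Md ω) ∂P)
        (∫ ω, φ (⌊T ω * n⌋₊ + 1) (gridSteps (n : ℝ≥0)⁻¹ N Md ω) ∂P) := by
  have hn' : (0 : ℝ) < n := by exact_mod_cast hn
  set ρ := Real.exp (-((n : ℝ≥0)⁻¹ / t)) with hρ
  have hρ0 : 0 ≤ ρ := (Real.exp_pos _).le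
  have hρ1 : ρ < 1 := by
    rw [hρ, Real.exp_lt_one_iff]
    have : 0 < (((n : ℝ≥0)⁻¹ : ℝ≥0) : ℝ) / t := by
      push_cast
      positivity
    linarith
  have hK : Measurable fun ω => ⌊T ω * n⌋₊ := Nat.measurable_floor.comp (hTm.mul_const _)
  have hs : Summable fun k => P.real ((fun ω => ⌊T ω * n⌋₊) ⁻¹' {k})
      * ∫ ω, ‖φ (k + 1) (gridSteps (n : ℝ≥0)⁻¹ N Md ω)‖ ∂P := by
    refine Summable.of_nonneg_of_le
      (fun k => mul_nonneg measureReal_nonneg (integral_nonneg fun ω => norm_nonneg _))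
      (fun k => ?_) (summable_geometric_mul_affine hρ0 hρ1 x y)
    rw [measureReal_floor_mul_eq ht hT hn k]
    exact mul_le_mul_of_nonneg_left (hb (k + 1))
      (mul_nonneg (by linarith) (pow_nonneg hρ0 k))
  obtain ⟨h1, h2⟩ := integral_comp_random_index hK (fun k => hi (k + 1))
    (fun k => indepFun_floor_gridSteps hTindep n _ (hφ (k + 1))) hs
  refine ⟨h1, ?_⟩
  convert! h2 using 2 with k
  rw [measureReal_floor_mul_eq ht hT hn k, ← hρ]
  push_cast
  rfl

variable [IsProbabilityMeasure P]

/-- The unit grid `n = 1` expresses this count as a sum of increments up to an independent geometric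
index. -/
theorem integrable_blocks_floor (ht : 0 < t)
    (hN : IsPoissonProcess N lam P) (hMd : IsPoissonProcess Md mud P)
    (hNMd : IndepFun (fun ω s => N s ω) (fun ω s => Md s ω) P)
    (hT : HasLaw (fun ω => (T ω : ℝ)) (expMeasure (1 / t)) P) (hTm : Measurable T)
    (hTindep : IndepFun T (fun ω => ((fun s => N s ω), (fun s => Md s ω))) P) :
    Integrable (fun ω => (N (⌊T ω⌋₊ + 1 : ℕ) ω : ℝ)) P := by
  have hst := isPoissonSteps_gridIncrement hN hMd hNMd 1
  have hφ : ∀ k : ℕ, Measurable fun s : (ℕ → ℕ) × (ℕ → ℕ) =>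
      ((∑ i ∈ Finset.range k, s.1 i : ℕ) : ℂ) := fun k => by
    refine Measurable.of_discrete.comp (Finset.measurable_sum _ fun i _ => ?_)
    exact (measurable_pi_apply i).comp measurable_fst
  have hi : ∀ k, Integrable (fun ω =>
      ∑ i ∈ Finset.range k, (gridIncrement 1 (fun s => N s ω) i : ℝ)) P := fun k =>
    integrable_finsetSum _ fun i _ => hst.integrable_fst i
  have h := (integral_gridSteps_floor ht hT hTm hTindep one_pos hφ (x := 0)
    (y := (lam * (1 : ℝ≥0)).toNNReal) (fun k => ?_) fun k => ?_).1.norm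
  · refine h.congr (ae_of_all _ fun ω => ?_)
    simp only [gridSteps, Nat.cast_one, inv_one, mul_one, Complex.norm_natCast]
    rw [sum_gridIncrement 1 (hN.mono ω) (hN.zero ω), mul_one]
  · refine ((hi k).ofReal (𝕜 := ℂ)).congr (ae_of_all _ fun ω => ?_)
    simp [gridSteps]
  · have e : ∀ ω, ‖((∑ i ∈ Finset.range k,
        (gridSteps ((1 : ℕ) : ℝ≥0)⁻¹ N Md ω).1 i : ℕ) : ℂ)‖
        = ∑ i ∈ Finset.range k, (gridIncrement 1 (fun s => N s ω) i : ℝ) := fun ω => by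
      rw [Complex.norm_natCast]
      simp [gridSteps]
    simp only [e]
    rw [integral_finsetSum _ fun i _ => hst.integrable_fst i]
    simp only [hst.integral_fst]
    simp [mul_comm]

/-- The mean of the discretized surviving surplus is close to a solution of the generator
equation. -/
theorem exists_norm_integral_killed_sub_le (hlam : 0 < lam) (hmud : 0 < mud) (ht : 0 < t)
    (hN : IsPoissonProcess N lam P) (hMd : IsPoissonProcess Md mud P)
    (hNMd : IndepFun (fun ω s => N s ω) (fun ω s => Md s ω) P)
    (hT : HasLaw (fun ω => (T ω : ℝ)) (expMeasure (1 / t)) P) (hTm : Measurable T)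
    (hTindep : IndepFun T (fun ω => ((fun s => N s ω), (fun s => Md s ω))) P)
    {C : ℝ} {f : ℤ → ℂ} (hf : LinearGrowth C f) (m w u : ℕ)
    (hgen : ∀ v : ℤ, 0 ≤ v → lam * f (v + m) + mud * f (v - w)
      - ((lam + mud + 1 / t : ℝ) : ℂ) * f v = - (v / t)) :
    ∃ K : ℝ, ∀ n : ℕ, 0 < n →
      Integrable (fun ω => killed m w u (fun v => v)
        (gridSteps (n : ℝ≥0)⁻¹ N Md ω) (⌊T ω * n⌋₊ + 1)) P ∧
      ‖(Real.exp (-((n : ℝ)⁻¹ / t)) : ℂ) * (∫ ω, killed m w u (fun v => v)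
        (gridSteps (n : ℝ≥0)⁻¹ N Md ω) (⌊T ω * n⌋₊ + 1) ∂P) - f u‖ ≤ K * (n : ℝ)⁻¹ := by
  obtain ⟨K, hK, hstep⟩ := exists_norm_sub_stepMean_le hlam.le hmud.le ht hf m w hgen
  -- From `1 - ρ ≤ h / t` and `(1 - ρ)⁻¹ ≤ (t + 1) / h`: the one-step error `K h ^ 2` meets `1 / h`
  -- in the first term and `h / h ^ 2` in the second, since the step mean is `lam * h`.
  refine ⟨u / t + K * ((1 + u) * (t + 1) + m * lam * (t + 1) ^ 2), fun n hn => ?_⟩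
  have hn' : (1 : ℝ) ≤ n := by exact_mod_cast hn
  set h : ℝ := (n : ℝ)⁻¹ with hh
  have hh0 : 0 < h := by positivity
  have hh1 : h ≤ 1 := inv_le_one_of_one_le₀ hn'
  set ρ := Real.exp (-(h / t)) with hρ
  have hht : 0 < h / t := by positivity
  have hρ0 : 0 ≤ ρ := (Real.exp_pos _).le
  have hρ1 : ρ < 1 := by
    rw [hρ, Real.exp_lt_one_iff]
    linarith
  have hρa : 1 - ρ ≤ h / t := by
    have := Real.add_one_le_exp (-(h / t))
    linarith
  have hρb : (1 - ρ)⁻¹ ≤ (t + 1) / h := by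
    -- `exp (h / t) ≥ 1 + h / t` gives `1 - ρ ≥ h / (h + t)`, and `h ≤ 1`.
    have h1 : h / (t + 1) ≤ 1 - ρ := by
      have h2 := Real.add_one_le_exp (h / t)
      have h3 : ρ * Real.exp (h / t) = 1 := by
        rw [hρ, ← Real.exp_add, neg_add_cancel, Real.exp_zero]
      have h4 : ρ * (h / t + 1) ≤ 1 := by
        calc _ ≤ ρ * Real.exp (h / t) := mul_le_mul_of_nonneg_left h2 hρ0
          _ = 1 := h3
      have h5 : ρ ≤ t / (h + t) := by
        rw [le_div_iff₀ (by positivity)]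
        have h6 : ρ * (h / t + 1) * t ≤ 1 * t := mul_le_mul_of_nonneg_right h4 ht.le
        have h7 : ρ * (h / t + 1) * t = ρ * (h + t) := by field_simp
        linarith
      have h6 : 1 - t / (h + t) = h / (h + t) := by field_simp; ring
      have h7 : h / (t + 1) ≤ h / (h + t) := by
        exact div_le_div_of_nonneg_left hh0.le (by positivity) (by linarith)
      linarith
    rw [← inv_div]
    exact inv_anti₀ (by positivity) h1
  have hsteps := isPoissonSteps_gridIncrement hN hMd hNMd (n : ℝ≥0)⁻¹
  have hcast : (((n : ℝ≥0)⁻¹ : ℝ≥0) : ℝ) = h := by simp [hh]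
  rw [hcast] at hsteps
  have hid : ∀ v : ℤ, 0 ≤ v → ‖(v : ℂ)‖ ≤ 1 * (1 + v) := fun v hv => by
    have : (0 : ℝ) ≤ v := by exact_mod_cast hv
    rw [Complex.norm_intCast, abs_of_nonneg this]
    linarith
  have hu : (0 : ℤ) ≤ u := Int.natCast_nonneg u
  obtain ⟨V, hV, hVb⟩ := hsteps.exists_hasSum_killed m w hu hρ0 hρ1 (by positivity) hf
    (hstep h hh0 hh1)
  obtain ⟨hint, hsum⟩ := integral_gridSteps_floor ht hT hTm hTindep hn
    (fun k => measurable_killed m w u (fun v => (v : ℂ)) k)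
    (fun k => hsteps.integrable_killed m w hu zero_le_one hid k)
    (x := 1 + u) (y := m * (lam * h).toNNReal)
    (fun k => (hsteps.integral_norm_killed_le m w hu zero_le_one hid k).trans_eq
      (by push_cast; ring))
  refine ⟨hint, ?_⟩
  rw [hcast] at hsum
  rw [hsum.unique hV]
  refine hVb.trans ?_
  rw [Real.coe_toNNReal _ (by positivity)]
  push_cast
  have b1 : (1 - ρ) * u ≤ h / t * u := by gcongr
  have b2 : (1 + u : ℝ) / (1 - ρ) ≤ (1 + u) * ((t + 1) / h) := by
    rw [div_eq_mul_inv]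
    gcongr
  have b3 : m * (lam * h) / (1 - ρ) ^ 2 ≤ m * (lam * h) * ((t + 1) / h) ^ 2 := by
    rw [div_eq_mul_inv, ← inv_pow]
    have : 0 ≤ (1 - ρ)⁻¹ := inv_nonneg.mpr (by linarith)
    gcongr
  calc _ ≤ h / t * u + K * h ^ 2 * ((1 + u) * ((t + 1) / h)
        + m * (lam * h) * ((t + 1) / h) ^ 2) := by gcongr
    _ = _ := by
      field_simp

theorem integral_survivingSurplus_of_measurable (hlam : 0 < lam) (hmud : 0 < mud) (ht : 0 < t)
    (hN : IsPoissonProcess N lam P) (hMd : IsPoissonProcess Md mud P)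
    (hNMd : IndepFun (fun ω s => N s ω) (fun ω s => Md s ω) P)
    (hT : HasLaw (fun ω => (T ω : ℝ)) (expMeasure (1 / t)) P) (hTm : Measurable T)
    (hTindep : IndepFun T (fun ω => ((fun s => N s ω), (fun s => Md s ω))) P)
    {b w : ℕ} (hwb : w < b) (u : ℕ) {C : ℝ} {f : ℤ → ℂ} (hf : LinearGrowth C f)
    (hgen : ∀ v : ℤ, 0 ≤ v → lam * f (v + (b - w : ℕ)) + mud * f (v - w)
      - ((lam + mud + 1 / t : ℝ) : ℂ) * f v = - (v / t)) :
    Integrable (survivingSurplus (poolSurplus u b w N (shareProcess N Md)) T) P ∧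
      ((∫ ω, survivingSurplus (poolSurplus u b w N (shareProcess N Md)) T ω ∂P : ℝ) : ℂ)
        = f u := by
  set S := survivingSurplus (poolSurplus u b w N (shareProcess N Md)) T with hS
  obtain ⟨K, hK⟩ := exists_norm_integral_killed_sub_le hlam hmud ht hN hMd hNMd hT hTm hTindep hf
    (b - w) w u hgen
  set Z : ℕ → Ω → ℂ := fun n ω => killed (b - w) w u (fun v => v)
    (gridSteps ((n + 1 : ℕ) : ℝ≥0)⁻¹ N Md ω) (⌊T ω * (n + 1 : ℕ)⌋₊ + 1) with hZ
  have hlim : ∀ ω, Tendsto (fun n => Z n ω) atTop (𝓝 (S ω : ℂ)) := fun ω =>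
    (tendsto_killed_gridSteps hN hMd hwb u T ω).comp (tendsto_add_atTop_nat 1)
  have hZi : ∀ n, Integrable (Z n) P := fun n => (hK (n + 1) n.succ_pos).1
  have hdom : Integrable
      (fun ω => 1 + (u : ℝ) + (b - w : ℕ) * (N (⌊T ω⌋₊ + 1 : ℕ) ω : ℝ)) P :=
    (integrable_const _).add
      ((integrable_blocks_floor ht hN hMd hNMd hT hTm hTindep).const_mul _)
  have hbound : ∀ n ω, ‖Z n ω‖ ≤ 1 + (u : ℝ) + (b - w : ℕ) * (N (⌊T ω⌋₊ + 1 : ℕ) ω : ℝ) :=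
    fun n ω => norm_killed_gridSteps_le hN (b - w) w u T ω n.succ_pos
  have hSm : AEStronglyMeasurable (fun ω => (S ω : ℂ)) P :=
    aestronglyMeasurable_of_tendsto_ae atTop (fun n => (hZi n).1) (ae_of_all _ hlim)
  have hSi : Integrable (fun ω => (S ω : ℂ)) P :=
    hdom.mono' hSm (ae_of_all _ fun ω => le_of_tendsto' (hlim ω).norm fun n => hbound n ω)
  refine ⟨by simpa using hSi.re, ?_⟩
  have hconv : Tendsto (fun n => ∫ ω, Z n ω ∂P) atTop (𝓝 (∫ ω, (S ω : ℂ) ∂P)) :=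
    tendsto_integral_of_dominated_convergence _ (fun n => (hZi n).1) hdom
      (fun n => ae_of_all _ (hbound n)) (ae_of_all _ hlim)
  have hinv : Tendsto (fun n : ℕ => ((n + 1 : ℕ) : ℝ)⁻¹) atTop (𝓝 0) :=
    (tendsto_inv_atTop_zero.comp tendsto_natCast_atTop_atTop).comp (tendsto_add_atTop_nat 1)
  have hρ : Tendsto (fun n : ℕ => (Real.exp (-(((n + 1 : ℕ) : ℝ)⁻¹ / t)) : ℂ)) atTop (𝓝 1) := by
    have h1 : Tendsto (fun n : ℕ => -(((n + 1 : ℕ) : ℝ)⁻¹ / t)) atTop (𝓝 0) := by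
      simpa using (hinv.div_const t).neg
    have h2 := (Complex.continuous_ofReal.tendsto _).comp
      ((Real.continuous_exp.tendsto _).comp h1)
    rw [Real.exp_zero, Complex.ofReal_one] at h2
    exact h2
  have h1 := hρ.mul hconv
  rw [one_mul] at h1
  -- The same sequence tends to `f u` by the `O(1/n)` estimate, and to the expectation by dominated
  -- convergence.
  have h2 : Tendsto (fun n : ℕ => (Real.exp (-(((n + 1 : ℕ) : ℝ)⁻¹ / t)) : ℂ)
      * ∫ ω, Z n ω ∂P) atTop (𝓝 (f u)) := by
    rw [tendsto_iff_norm_sub_tendsto_zero]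
    refine squeeze_zero (fun n => norm_nonneg _) (fun n => (hK (n + 1) n.succ_pos).2) ?_
    simpa using hinv.const_mul K
  rw [← integral_complex_ofReal]
  exact tendsto_nhds_unique h1 h2

/-- The law of `T` yields only almost-everywhere measurability, so `T` is exchanged for a measurable
version; law, independence and integral are unaffected. -/
theorem integral_survivingSurplus (hlam : 0 < lam) (hmud : 0 < mud) (ht : 0 < t)
    (hN : IsPoissonProcess N lam P) (hMd : IsPoissonProcess Md mud P)
    (hNMd : IndepFun (fun ω s => N s ω) (fun ω s => Md s ω) P)
    (hT : HasLaw (fun ω => (T ω : ℝ)) (expMeasure (1 / t)) P)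
    (hTindep : IndepFun T (fun ω => ((fun s => N s ω), (fun s => Md s ω))) P)
    {b w : ℕ} (hwb : w < b) (u : ℕ) {C : ℝ} {f : ℤ → ℂ} (hf : LinearGrowth C f)
    (hgen : ∀ v : ℤ, 0 ≤ v → lam * f (v + (b - w : ℕ)) + mud * f (v - w)
      - ((lam + mud + 1 / t : ℝ) : ℂ) * f v = - (v / t)) :
    Integrable (survivingSurplus (poolSurplus u b w N (shareProcess N Md)) T) P ∧
      ((∫ ω, survivingSurplus (poolSurplus u b w N (shareProcess N Md)) T ω ∂P : ℝ) : ℂ)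
        = f u := by
  have hTae : AEMeasurable T P := by
    have h := measurable_real_toNNReal.comp_aemeasurable hT.aemeasurable
    refine h.congr (ae_of_all _ fun ω => ?_)
    simp
  obtain ⟨T', hTm, hTT⟩ := hTae
  have hT' : HasLaw (fun ω => (T' ω : ℝ)) (expMeasure (1 / t)) P := by
    refine hT.congr ?_
    filter_upwards [hTT] with ω hω
    rw [hω]
  have hind := hTindep.congr hTT Filter.EventuallyEq.rfl
  have hSS : survivingSurplus (poolSurplus u b w N (shareProcess N Md)) T' =ᵐ[P]
      survivingSurplus (poolSurplus u b w N (shareProcess N Md)) T := by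
    filter_upwards [hTT] with ω hω
    simp only [survivingSurplus, Set.indicator, Set.mem_ofPred_eq, hω]
  obtain ⟨h1, h2⟩ := integral_survivingSurplus_of_measurable hlam hmud ht hN hMd hNMd hT' hTm hind
    hwb u hf hgen
  exact ⟨h1.congr hSS, by rw [← integral_congr_ae hSS, h2]⟩

end value

/-! ### Assembly of the roots, the linear system and the value function -/

theorem theorem3p2
    {Ω : Type*} [MeasurableSpace Ω] (P : Measure Ω) [IsProbabilityMeasure P]
    (b w : ℕ) (hw : 0 < w) (hwb : w < b)
    (lam mud t : ℝ) (hlam : 0 < lam) (hmud : 0 < mud) (ht : 0 < t)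
    (N Md : ℝ≥0 → Ω → ℕ) (T : Ω → ℝ≥0)
    (hN : IsPoissonProcess N lam P) (hMd : IsPoissonProcess Md mud P)
    (hNMd : IndepFun (fun ω s => N s ω) (fun ω s => Md s ω) P)
    (hT : HasLaw (fun ω => (T ω : ℝ)) (expMeasure (1 / t)) P)
    (hTindep : IndepFun T (fun ω => ((fun s => N s ω), (fun s => Md s ω))) P) :
    (∀ (u : ℝ) (s : ℝ≥0) (ω : Ω),
      poolSurplus u b w N (shareProcess N Md) s ω
        = u - (w : ℝ) * Md s ω + ((b : ℝ) - w) * N s ω) ∧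
    (diskRoots lam mud t b w).card = w ∧
    ∀ x : Fin w → ℂ, Finset.univ.val.map x = diskRoots lam mud t b w →
      Function.Injective x ∧
      (∃! c : Fin w → ℂ,
        (poolMatrix lam mud t b w x).mulVec c = poolRhs lam mud t b w) ∧
      ∀ c : Fin w → ℂ,
        (poolMatrix lam mud t b w x).mulVec c = poolRhs lam mud t b w →
        ∀ u : ℕ,
          Integrable (survivingSurplus (poolSurplus u b w N (shareProcess N Md)) T) P ∧
          ((∫ ω, survivingSurplus (poolSurplus u b w N (shareProcess N Md)) T ω ∂P : ℝ) : ℂ)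
            = (∑ i, c i * x i ^ u) + u + lam * b * t - (lam + mud) * w * t := by
  refine ⟨fun u s ω => poolSurplus_shareProcess u b w N Md s ω, card_diskRoots hlam hmud ht,
    fun x hx => ⟨injective_of_map_eq_diskRoots hlam hmud ht hw hwb hx,
      existsUnique_poolMatrix hlam hmud ht hw hwb hx _, fun c hc u => ?_⟩⟩
  have hmem : ∀ i, x i ∈ diskRoots lam mud t b w := fun i => by
    rw [← hx]
    exact Multiset.mem_map_of_mem x (Finset.mem_univ i)
  set d : ℂ := lam * b * t - (lam + mud) * w * t with hd
  obtain ⟨C, hC, hCb⟩ := exists_norm_poolValue_le c x d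
    fun i => (mem_diskRoots hlam hmud hw (hmem i)).1
  have hf : LinearGrowth C (poolValue c x d) :=
    ⟨hC, fun v hv => poolValue_of_neg c x d hv, hCb⟩
  obtain ⟨h1, h2⟩ := integral_survivingSurplus hlam hmud ht hN hMd hNMd hT hTindep hwb u hf
    fun v hv => poolValue_generator hlam hmud ht hw hwb hmem hc hd hv
  refine ⟨h1, ?_⟩
  rw [h2, poolValue_natCast, hd]
  ring
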